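/- All graphs are finite and simple, and isomorphic graphs are not distinguished. (A 3-connected cubic graph never has parallel edges.) A graph is cubic if every vertex has degree 3, and 3-connected if it has more than three vertices and stays connected after the deletion of any fewer than three vertices. An edge of a graph is called lonely if it belongs to exactly one perfect matching of the graph. Let $\mathcal{U}$ be the class of all 3-connected cubic graphs that have at least one lonely edge. For a cubic graph $G$ and a vertex $v$ of $G$ with neighbours $x_1,x_2,x_3$, let $G^v$ be the graph obtained from $G$ by replacing $v$ with a triangle, that is, with new vertices $v_1,v_2,v_3$, $$V(G^v)=(V(G)\setminus\{v\})\cup\{v_1,v_2,v_3\},$$ $$E(G^v)=(E(G)\setminus\{vx_1,vx_2,vx_3\})\cup\{v_1x_1,v_2x_2,v_3x_3\}\cup\{v_1v_2,v_2v_3,v_3v_1\}.$$ A $v$-join of $G$ is a spanning subgraph of $G$ in which $v$ has degree 3 and every other vertex has degree 1. Proposition. The class $\mathcal{U}$ is defined inductively by the following two rules, i.e. it is the smallest class of graphs satisfying both: (i) $K_4\in\mathcal{U}$; (ii) if $G\in\mathcal{U}$, $e\in E(G)$ is a lonely edge of $G$, and $v\in V(G)$ is either incident with $e$ or such that no $v$-join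 of $G$ contains $e$, then $G^v\in\mathcal{U}$. In particular, $\mathcal{U}$ satisfies (i) and (ii), and every member of $\mathcal{U}$ is obtained from $K_4$ by finitely many applications of (ii). -/

import Mathlib

universe u

namespace CubicGraph

/-- Every vertex has exactly three neighbours. -/
def IsCubic {V : Type u} (G : SimpleGraph V) : Prop :=
  ∀ v : V, (G.neighborSet v).ncard = 3

/-- A finite graph with more than three vertices that stays connected after the deletion of any
set of fewer than three vertices. -/
def IsThreeConnected {V : Type u} (G : SimpleGraph V) : Prop :=
  Finite V ∧ 3 < Nat.card V ∧ ∀ S : Set V, S.ncard < 3 → (G.induce Sᶜ).Connected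

/-- An edge of `G` that belongs to exactly one perfect matching of `G`. -/
def IsLonely {V : Type u} (G : SimpleGraph V) (e : Sym2 V) : Prop :=
  e ∈ G.edgeSet ∧ ∃! M : G.Subgraph, M.IsPerfectMatching ∧ e ∈ M.edgeSet

/-- A spanning subgraph in which `v` has degree 3 and every other vertex has degree 1. -/
def IsJoin {V : Type u} {G : SimpleGraph V} (v : V) (J : G.Subgraph) : Prop :=
  J.IsSpanning ∧ (J.neighborSet v).ncard = 3 ∧ ∀ w : V, w ≠ v → (J.neighborSet w).ncard = 1

/-- The class of 3-connected cubic graphs having a lonely edge. -/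
def InU {V : Type u} (G : SimpleGraph V) : Prop :=
  IsCubic G ∧ IsThreeConnected G ∧ ∃ e : Sym2 V, IsLonely G e

/-- The graph obtained from `G` by replacing the vertex `v` with a triangle. Its vertices are the
vertices of `G` other than `v`, and one new vertex `Sum.inr x` for every neighbour `x` of `v`. The
new vertices are pairwise adjacent, and the new vertex of `x` is adjacent to `x`. -/
def replaceByTriangle {V : Type u} (G : SimpleGraph V) (v : V) :
    SimpleGraph ({w : V // w ≠ v} ⊕ {x : V // G.Adj v x}) where
  Adj
    | Sum.inl a, Sum.inl b => G.Adj a.1 b.1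
    | Sum.inl a, Sum.inr x => a.1 = x.1
    | Sum.inr x, Sum.inl a => a.1 = x.1
    | Sum.inr x, Sum.inr y => x ≠ y
  symm := ⟨by
    rintro (a | x) (b | y) h
    · exact SimpleGraph.Adj.symm h
    · exact h
    · exact h
    · exact Ne.symm h⟩
  loopless := ⟨by
    rintro (a | x) h
    · exact G.loopless.irrefl _ h
    · exact h rfl⟩

/-- The smallest class of graphs, with isomorphic graphs not distinguished, that contains the
complete graph on four vertices and that contains, with `G`, the graph obtained by replacing `v`
with a triangle whenever `G` has a lonely edge `e` that is incident with `v` or is contained in no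
`v`-join of `G`. -/
inductive Generated : ∀ {V : Type u}, SimpleGraph V → Prop
  | base {V : Type u} (G : SimpleGraph V)
      (iso : Nonempty (G ≃g (⊤ : SimpleGraph (Fin 4)))) : Generated G
  | step {V W : Type u} (G : SimpleGraph V) (e : Sym2 V) (v : V) (H : SimpleGraph W)
      (hG : Generated G) (he : IsLonely G e)
      (hv : v ∈ e ∨ ¬ ∃ J : G.Subgraph, IsJoin v J ∧ e ∈ J.edgeSet)
      (iso : Nonempty (H ≃g replaceByTriangle G v)) : Generated H

end CubicGraph

/-! Write G^v for `replaceByTriangle G v`. For cubic G, a perfect matching of G^v with an edge in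
the triangle corresponds to a perfect matching of G, and one without such an edge to a v-join of G.
Hence the condition on v carries a lonely edge of G to one of G^v. Conversely, a lonely edge of G^v
whose matching uses a triangle edge yields a lonely edge of G for which the condition holds. For
cubic graphs, 3-connectedness means that every edge cut has at least three edges, and this property
passes both ways between G and G^v.

It remains to find, for the unique matching m through a lonely edge at x, a triangle containing an
edge of m; if there are more than four vertices, contracting it allows induction. The search
(`exists_triangle_of_cut`) runs over sets S avoiding x, with at least three vertices, three leaving
edges and exactly one edge of m leaving; the first is the complement of x. Let s be the end in S of
that edge and U = S - s; then U has four leaving edges. For a in U, uniqueness forbids a perfect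
matching of U avoiding the edge a m(a), so Tutte's theorem gives a set X with at least |X| + 2 odd
components once that edge is deleted. Counting edges (`exists_tight_barrier`) turns every estimate
into an equality, and each component again has three leaving edges, one of them in m.

A component with three or more vertices permits recursion. Suppose all are single vertices. If X is
empty, then U = {a, m(a)} and s completes a triangle. Otherwise some y in X gives a second barrier
X' that misses y, and the symmetric difference of X and X' has at most two leaving edges, a
contradiction. -/

namespace CubicGraph

/-! ### Perfect matchings as relations, and invariance under isomorphism -/

/-- A perfect matching of `G`, as a symmetric relation. -/
def IsPM {V : Type u} (G : SimpleGraph V) (R : V → V → Prop) : Prop :=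
  (∀ a b, R a b → R b a) ∧ (∀ a b, R a b → G.Adj a b) ∧ ∀ a, ∃! b, R a b

theorem IsPM.eq {V : Type u} {G : SimpleGraph V} {R : V → V → Prop} (h : IsPM G R) {a b c : V}
    (hb : R a b) (hc : R a c) : b = c :=
  (h.2.2 a).unique hb hc

theorem isPM_of_isPerfectMatching {V : Type u} {G : SimpleGraph V} {M : G.Subgraph}
    (h : M.IsPerfectMatching) : IsPM G M.Adj :=
  ⟨fun _ _ h => h.symm, fun _ _ h => h.adj_sub, fun a => h.1 (h.2 a)⟩

/-- The spanning subgraph with a given adjacency relation. -/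
def subgraphOfRel {V : Type u} (G : SimpleGraph V) (R : V → V → Prop)
    (hs : ∀ a b, R a b → R b a) (hG : ∀ a b, R a b → G.Adj a b) : G.Subgraph where
  verts := Set.univ
  Adj := R
  adj_sub h := hG _ _ h
  edge_vert _ := Set.mem_univ _
  symm := ⟨fun a b h => hs a b h⟩

theorem IsPM.isPerfectMatching {V : Type u} {G : SimpleGraph V} {R : V → V → Prop}
    (h : IsPM G R) : (subgraphOfRel G R h.1 h.2.1).IsPerfectMatching :=
  ⟨fun a _ => h.2.2 a, fun _ => Set.mem_univ _⟩

theorem isLonely_iff {V : Type u} {G : SimpleGraph V} {x y : V} :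
    IsLonely G s(x, y) ↔ ∃! R, IsPM G R ∧ R x y := by
  constructor
  · rintro ⟨-, M, ⟨hM, hxy⟩, hu⟩
    refine ⟨M.Adj, ⟨isPM_of_isPerfectMatching hM, hxy⟩, ?_⟩
    rintro R ⟨hR, hRxy⟩
    have := hu (subgraphOfRel G R hR.1 hR.2.1) ⟨hR.isPerfectMatching, hRxy⟩
    rw [← this]; rfl
  · rintro ⟨R, ⟨hR, hxy⟩, hu⟩
    refine ⟨hR.2.1 _ _ hxy, subgraphOfRel G R hR.1 hR.2.1, ⟨hR.isPerfectMatching, hxy⟩, ?_⟩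
    rintro M ⟨hM, hMxy⟩
    have := hu M.Adj ⟨isPM_of_isPerfectMatching hM, hMxy⟩
    ext a b
    · exact ⟨fun _ => Set.mem_univ _, fun _ => hM.2 a⟩
    · rw [this]; rfl

theorem IsPM.comap {V W : Type u} {G : SimpleGraph V} {H : SimpleGraph W} (φ : G ≃g H)
    {R : W → W → Prop} (h : IsPM H R) : IsPM G (fun a b => R (φ a) (φ b)) := by
  refine ⟨fun a b => h.1 _ _, fun a b hab => φ.map_adj_iff.1 (h.2.1 _ _ hab), fun a => ?_⟩
  obtain ⟨b, hb, hu⟩ := h.2.2 (φ a)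
  refine ⟨φ.symm b, by simpa using hb, fun c hc => ?_⟩
  rw [← hu _ hc]; simp

theorem IsLonely.map {V W : Type u} {G : SimpleGraph V} {H : SimpleGraph W} (φ : G ≃g H)
    {x y : V} (h : IsLonely G s(x, y)) : IsLonely H s(φ x, φ y) := by
  rw [isLonely_iff] at h ⊢
  obtain ⟨R, ⟨hR, hxy⟩, hu⟩ := h
  refine ⟨fun a b => R (φ.symm a) (φ.symm b), ⟨hR.comap φ.symm, by simpa using hxy⟩, ?_⟩
  rintro R' ⟨hR', hxy'⟩
  have := hu _ ⟨hR'.comap φ, hxy'⟩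
  rw [← this]; simp

theorem isCubic_of_iso {V W : Type u} {G : SimpleGraph V} {H : SimpleGraph W} (φ : G ≃g H)
    (h : IsCubic G) : IsCubic H := by
  intro w
  have h1 := h (φ.symm w)
  have : H.neighborSet w = φ '' (G.neighborSet (φ.symm w)) := by
    ext b
    simp only [SimpleGraph.mem_neighborSet, Set.mem_image]
    constructor
    · intro hb
      exact ⟨φ.symm b, φ.symm.map_adj_iff.2 hb, by simp⟩
    · rintro ⟨c, hc, rfl⟩
      simpa using φ.map_adj_iff.2 hc
  rw [this, Set.ncard_image_of_injective _ φ.injective, h1]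

theorem isThreeConnected_of_iso {V W : Type u} {G : SimpleGraph V} {H : SimpleGraph W}
    (φ : G ≃g H) (h : IsThreeConnected G) : IsThreeConnected H := by
  obtain ⟨hf, hc, hS⟩ := h
  refine ⟨Finite.of_equiv V φ.toEquiv, by rwa [← Nat.card_congr φ.toEquiv], fun S hS3 => ?_⟩
  have h1 := hS (φ ⁻¹' S) (by
    rwa [Set.ncard_preimage_of_injective_subset_range φ.injective (by simp [φ.surjective.range_eq])])
  let ψ : G.induce (φ ⁻¹' S)ᶜ →g H.induce Sᶜ :=
    ⟨fun a => ⟨φ a.1, a.2⟩, fun {a b} hab => φ.map_adj_iff.2 hab⟩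
  refine h1.map ψ ?_
  rintro ⟨b, hb⟩
  exact ⟨⟨φ.symm b, by simpa using hb⟩, Subtype.ext (φ.apply_symm_apply b)⟩

theorem InU.of_iso {V W : Type u} {G : SimpleGraph V} {H : SimpleGraph W} (φ : G ≃g H)
    (h : InU G) : InU H := by
  obtain ⟨h1, h2, e, he⟩ := h
  induction e with | _ x y
  exact ⟨isCubic_of_iso φ h1, isThreeConnected_of_iso φ h2, _, he.map φ⟩

/-! ### The complete graph on four vertices -/

theorem inU_completeGraph_four : InU (⊤ : SimpleGraph (ULift.{u} (Fin 4))) := by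
  refine ⟨fun v => ?_, ⟨inferInstance, by simp, fun S hS => ?_⟩, s(⟨0⟩, ⟨1⟩), ?_⟩
  · have : (⊤ : SimpleGraph (ULift.{u} (Fin 4))).neighborSet v = {v}ᶜ := by
      ext b; simp [eq_comm]
    rw [this, Set.ncard_compl]
    simp
  · have : Nonempty ↑(Sᶜ) := by
      rw [Set.nonempty_coe_sort, Set.nonempty_compl]
      rintro rfl
      simp [Set.ncard_univ] at hS
    rw [SimpleGraph.induce_top]
    exact SimpleGraph.connected_top
  · rw [isLonely_iff]
    -- The matching {01, 23}: sum 1 singles out the pair 0, 1, and sum 5 the pair 2, 3.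
    refine ⟨fun a b => a.down.val + b.down.val = 1 ∨ a.down.val + b.down.val = 5, ⟨⟨?_, ?_, ?_⟩, by simp⟩, ?_⟩
    · intro a b; omega
    · rintro ⟨a⟩ ⟨b⟩ h
      simp only [SimpleGraph.top_adj, ne_eq, ULift.up.injEq] at h ⊢
      omega
    · rintro ⟨a⟩
      fin_cases a
      · exact ⟨⟨1⟩, by simp, by rintro ⟨b⟩; fin_cases b <;> simp⟩
      · exact ⟨⟨0⟩, by simp, by rintro ⟨b⟩; fin_cases b <;> simp⟩
      · exact ⟨⟨3⟩, by simp, by rintro ⟨b⟩; fin_cases b <;> simp⟩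
      · exact ⟨⟨2⟩, by simp, by rintro ⟨b⟩; fin_cases b <;> simp⟩
    · rintro R ⟨hR, h01⟩
      have h10 := hR.1 _ _ h01
      have h23 : R ⟨2⟩ ⟨3⟩ := by
        obtain ⟨⟨b⟩, hb, -⟩ := hR.2.2 ⟨2⟩
        have hn := hR.2.1 _ _ hb
        fin_cases b
        · have := hR.eq h01 (hR.1 _ _ hb); simp at this
        · have := hR.eq h10 (hR.1 _ _ hb); simp at this
        · simp at hn
        · exact hb
      have h32 := hR.1 _ _ h23
      ext ⟨a⟩ ⟨b⟩
      have key : ∀ a b c : Fin 4, R ⟨a⟩ ⟨b⟩ → (R ⟨a⟩ ⟨c⟩ ↔ b = c) := fun a b c h =>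
        ⟨fun h' => ULift.up.inj (hR.eq h h'), fun h' => h' ▸ h⟩
      fin_cases a
      · exact (key _ _ _ h01).trans (by fin_cases b <;> simp)
      · exact (key _ _ _ h10).trans (by fin_cases b <;> simp)
      · exact (key _ _ _ h23).trans (by fin_cases b <;> simp)
      · exact (key _ _ _ h32).trans (by fin_cases b <;> simp)

/-! ### Counting edges between vertex sets -/

open Classical in
/-- The number of pairs of adjacent vertices, the first in `A` and the second in `B`. -/
noncomputable def edgeCount {V : Type u} (G : SimpleGraph V) (A B : Finset V) : ℕ :=
  ∑ a ∈ A, ∑ b ∈ B, if G.Adj a b then 1 else 0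

theorem edgeCount_comm {V : Type u} (G : SimpleGraph V) (A B : Finset V) :
    edgeCount G A B = edgeCount G B A := by
  unfold edgeCount
  classical
  rw [Finset.sum_comm]
  exact Finset.sum_congr rfl fun a _ => Finset.sum_congr rfl fun b _ =>
    if_congr (G.adj_comm _ _) rfl rfl

theorem edgeCount_union_left {V : Type u} [DecidableEq V] (G : SimpleGraph V) {A B : Finset V}
    (C : Finset V) (h : Disjoint A B) :
    edgeCount G (A ∪ B) C = edgeCount G A C + edgeCount G B C :=
  Finset.sum_union h

theorem edgeCount_union_right {V : Type u} [DecidableEq V] (G : SimpleGraph V) (C : Finset V)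
    {A B : Finset V} (h : Disjoint A B) :
    edgeCount G C (A ∪ B) = edgeCount G C A + edgeCount G C B := by
  rw [edgeCount_comm, edgeCount_union_left G C h, edgeCount_comm G A, edgeCount_comm G B]

theorem edgeCount_eq_zero_iff {V : Type u} {G : SimpleGraph V} {A B : Finset V} :
    edgeCount G A B = 0 ↔ ∀ a ∈ A, ∀ b ∈ B, ¬ G.Adj a b := by
  simp [edgeCount, Finset.sum_eq_zero_iff]

theorem edgeCount_mono {V : Type u} (G : SimpleGraph V) {A B A' B' : Finset V} (hA : A ⊆ A')
    (hB : B ⊆ B') : edgeCount G A B ≤ edgeCount G A' B' := by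
  unfold edgeCount
  exact (Finset.sum_le_sum fun a _ => Finset.sum_le_sum_of_subset hB).trans
    (Finset.sum_le_sum_of_subset hA)

open Classical in
theorem edgeCount_singleton_left {V : Type u} (G : SimpleGraph V) (v : V) (B : Finset V) :
    edgeCount G {v} B = (B.filter (G.Adj v)).card := by
  rw [edgeCount, Finset.sum_singleton, Finset.card_filter]

open Classical in
theorem edgeCount_eq_sum {V : Type u} (G : SimpleGraph V) (A B : Finset V) :
    edgeCount G A B = ∑ a ∈ A, (B.filter (G.Adj a)).card := by
  simp only [edgeCount, Finset.card_filter]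

theorem edgeCount_sum_left {V : Type u} (G : SimpleGraph V) (A B : Finset V) :
    edgeCount G A B = ∑ a ∈ A, edgeCount G {a} B := by
  simp [edgeCount]

theorem IsCubic.edgeCount_univ {V : Type u} [Fintype V] {G : SimpleGraph V} (h : IsCubic G)
    (A : Finset V) : edgeCount G A Finset.univ = 3 * A.card := by
  classical
  rw [edgeCount_eq_sum, Finset.sum_congr rfl (g := fun _ => 3), Finset.sum_const, smul_eq_mul,
    mul_comm]
  intro a _
  rw [← h a, ← Set.ncard_coe_finset]
  congr 1
  ext b; simp

theorem edgeCount_self_le {V : Type u} (G : SimpleGraph V) (A : Finset V) :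
    edgeCount G A A ≤ A.card * (A.card - 1) := by
  classical
  rw [edgeCount_eq_sum]
  refine (Finset.sum_le_card_nsmul A _ (A.card - 1) fun a ha => ?_).trans_eq (smul_eq_mul _ _)
  rw [← Finset.card_erase_of_mem ha]
  refine Finset.card_le_card fun b hb => ?_
  rw [Finset.mem_filter] at hb
  exact Finset.mem_erase.2 ⟨hb.2.ne', hb.1⟩

/-! ### Three-connectedness of cubic graphs through edge cuts -/

/-- The number of edges leaving a set of vertices. -/
noncomputable def cutSize {V : Type u} [Fintype V] [DecidableEq V] (G : SimpleGraph V)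
    (S : Finset V) : ℕ :=
  edgeCount G S Sᶜ

/-- Every edge cut has at least three edges. -/
def CutsGeThree {V : Type u} [Fintype V] [DecidableEq V] (G : SimpleGraph V) : Prop :=
  ∀ S : Finset V, S.Nonempty → Sᶜ.Nonempty → 3 ≤ cutSize G S

/-- This is the degree sum over `S`: an edge inside `S` is counted once in each direction. -/
theorem IsCubic.edgeCount_add_cutSize {V : Type u} [Fintype V] [DecidableEq V]
    {G : SimpleGraph V} (h : IsCubic G) (S : Finset V) :
    edgeCount G S S + cutSize G S = 3 * S.card := by
  rw [cutSize, ← edgeCount_union_right _ _ disjoint_compl_right, Finset.union_compl,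
    h.edgeCount_univ]

theorem IsCubic.three_lt_card {V : Type u} [Finite V] [Nonempty V] {G : SimpleGraph V}
    (h : IsCubic G) : 3 < Nat.card V := by
  obtain ⟨v⟩ := ‹Nonempty V›
  have : (insert v (G.neighborSet v)).ncard = 4 := by
    rw [Set.ncard_insert_of_notMem (by simp), h v]
  have h2 := Set.ncard_le_ncard (Set.subset_univ (insert v (G.neighborSet v)))
  rw [Set.ncard_univ] at h2
  omega

/-- The ends in `S` of fewer than three leaving edges form a set `X` of at most two vertices, which
separates the rest of `S` from the complement. -/
theorem IsThreeConnected.cutsGeThree {V : Type u} [Fintype V] [DecidableEq V]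
    {G : SimpleGraph V} (hc : IsCubic G) (h : IsThreeConnected G) : CutsGeThree G := by
  classical
  intro S hS hS'
  by_contra! hlt
  set X := S.filter (fun a => ∃ b ∉ S, G.Adj a b) with hX
  have hXle : X.card ≤ cutSize G S := by
    rw [cutSize, edgeCount_eq_sum]
    calc X.card = ∑ a ∈ X, 1 := by simp
      _ ≤ ∑ a ∈ X, (Sᶜ.filter (G.Adj a)).card := by
        refine Finset.sum_le_sum fun a ha => Finset.card_pos.2 ?_
        obtain ⟨-, b, hb, hab⟩ := Finset.mem_filter.1 ha
        exact ⟨b, by simp [hb, hab]⟩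
      _ ≤ _ := Finset.sum_le_sum_of_subset (Finset.filter_subset _ _)
  have hXS : X ⊆ S := Finset.filter_subset _ _
  -- If nothing of `S` is left, then |S| = k is 1 or 2, and at least 3k - k(k - 1) ≥ 3 edges leave
  -- `S`.
  by_cases hSX : S ⊆ X
  · have hcard : S.card ≤ 2 := by
      have := Finset.card_le_card hSX; omega
    have h1 := hc.edgeCount_add_cutSize S
    have h2 := edgeCount_self_le G S
    have h3 := hS.card_pos
    interval_cases hs : S.card <;> omega
  · obtain ⟨p, hpS, hpX⟩ := Finset.not_subset.1 hSX
    obtain ⟨q, hq⟩ := hS'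
    rw [Finset.mem_compl] at hq
    have hcon := h.2.2 (X : Set V) (by rw [Set.ncard_coe_finset]; omega)
    obtain ⟨w⟩ := hcon.preconnected ⟨p, by simpa using hpX⟩ ⟨q, by simpa using fun hh => hq (hXS hh)⟩
    obtain ⟨d, -, hd1, hd2⟩ := w.exists_boundary_dart {a | a.1 ∈ S} hpS hq
    exact d.fst.2 (by simpa [hX] using ⟨hd1, _, hd2, d.adj⟩)

/-- If `X` separates `P` from `Q`, each side sends at least three edges to `X`. As `X` has at most
two vertices of degree 3, it has exactly two, x and y, and no edge inside. If x sends p edges to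
`P`, it sends 3 - p to `Q`, while y sends 3 - p to `P` and p to `Q`. The cuts of `P ∪ {x}` and `P ∪
{y}` then have 2(3 - p) and 2p edges, and one of these is at most 2. -/
theorem CutsGeThree.isThreeConnected {V : Type u} [Fintype V] [DecidableEq V] [Nonempty V]
    {G : SimpleGraph V} (hc : IsCubic G) (h : CutsGeThree G) : IsThreeConnected G := by
  classical
  have hV := hc.three_lt_card
  refine ⟨inferInstance, hV, fun S hS => ?_⟩
  obtain ⟨X, rfl⟩ := S.toFinite.exists_finset_coe
  rw [Set.ncard_coe_finset] at hS
  have hne : Nonempty ↥((X : Set V)ᶜ) := by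
    rw [Set.nonempty_coe_sort, Set.nonempty_compl]
    intro hX
    rw [Finset.coe_eq_univ] at hX
    rw [hX, Finset.card_univ, ← Nat.card_eq_fintype_card] at hS
    omega
  refine ⟨fun u v => ?_⟩
  by_contra hr
  set P : Finset V := Finset.univ.filter
    (fun w => ∃ hw : w ∈ (X : Set V)ᶜ, (G.induce (X : Set V)ᶜ).Reachable u ⟨w, hw⟩) with hP
  set Q : Finset V := Xᶜ \ P with hQ
  have hPX : Disjoint P X := by
    rw [Finset.disjoint_left]
    intro w hw
    obtain ⟨-, hw, -⟩ := Finset.mem_filter.1 hw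
    simpa using hw
  have hPQ : edgeCount G P Q = 0 := by
    rw [edgeCount_eq_zero_iff]
    intro a ha b hb hab
    obtain ⟨-, ha', hra⟩ := Finset.mem_filter.1 ha
    rw [hQ, Finset.mem_sdiff, Finset.mem_compl] at hb
    refine hb.2 (Finset.mem_filter.2 ⟨Finset.mem_univ _, by simpa using hb.1, hra.trans ?_⟩)
    exact SimpleGraph.Adj.reachable (by simpa using hab)
  have huP : u.1 ∈ P := Finset.mem_filter.2 ⟨Finset.mem_univ _, u.2, SimpleGraph.Reachable.refl _⟩
  have hvQ : v.1 ∈ Q := by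
    rw [hQ, Finset.mem_sdiff, Finset.mem_compl]
    refine ⟨v.2, fun hv => hr ?_⟩
    obtain ⟨-, _, h⟩ := Finset.mem_filter.1 hv
    exact h
  have hQX : Disjoint Q X := Finset.disjoint_left.2 fun w hw => by
    rw [hQ, Finset.mem_sdiff, Finset.mem_compl] at hw; exact hw.1
  have hPQd : Disjoint P Q := Finset.disjoint_sdiff
  have hmem : ∀ w, w ∈ X ∨ w ∈ P ∨ w ∈ Q := fun w => by
    rw [hQ, Finset.mem_sdiff, Finset.mem_compl]; tauto
  have hPc : Pᶜ = X ∪ Q := by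
    ext w
    have := hmem w
    have h1 : w ∈ _ → w ∉ _ := fun hw => Finset.disjoint_left.1 hPX hw
    have h2 : w ∈ _ → w ∉ _ := fun hw => Finset.disjoint_left.1 hPQd hw
    simp only [Finset.mem_compl, Finset.mem_union]; grind
  have hQc : Qᶜ = X ∪ P := by
    ext w
    have := hmem w
    have h1 : w ∈ _ → w ∉ _ := fun hw => Finset.disjoint_left.1 hQX hw
    have h2 : w ∈ _ → w ∉ _ := fun hw => Finset.disjoint_left.1 hPQd hw
    simp only [Finset.mem_compl, Finset.mem_union]; grind
  have hXc : Xᶜ = P ∪ Q := by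
    ext w
    have := hmem w
    have h1 : w ∈ _ → w ∉ _ := fun hw => Finset.disjoint_left.1 hQX hw
    have h2 : w ∈ _ → w ∉ _ := fun hw => Finset.disjoint_left.1 hPX hw
    simp only [Finset.mem_compl, Finset.mem_union]; grind
  have cP : 3 ≤ edgeCount G P X := by
    have := h P ⟨_, huP⟩ ⟨v, by rw [hPc]; simp [hvQ]⟩
    rw [cutSize, hPc, edgeCount_union_right _ _ hQX.symm] at this
    omega
  have cQ : 3 ≤ edgeCount G Q X := by
    have := h Q ⟨_, hvQ⟩ ⟨u, by rw [hQc]; simp [huP]⟩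
    rw [cutSize, hQc, edgeCount_union_right _ _ hPX.symm, edgeCount_comm G Q P] at this
    omega
  have cX := hc.edgeCount_add_cutSize X
  rw [cutSize, hXc, edgeCount_union_right _ _ hPQd, edgeCount_comm G X P, edgeCount_comm G X Q] at cX
  have hX2 : X.card = 2 := by omega
  have hXX : edgeCount G X X = 0 := by omega
  obtain ⟨x, y, hxy, hXe⟩ := Finset.card_eq_two.1 hX2
  have hxX : x ∈ X := by simp [hXe]
  have hyX : y ∈ X := by simp [hXe]
  have hXu : X = {x} ∪ {y} := by rw [hXe]; rfl
  have hd : Disjoint ({x} : Finset V) {y} := by simpa using hxy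
  have key : ∀ x y, x ∈ X → X = {x} ∪ {y} → Disjoint ({x} : Finset V) {y} →
      3 ≤ edgeCount G P {y} + edgeCount G {x} Q := by
    intro x y hx hXu hd
    have hPx : Disjoint P {x} := hPX.mono_right (by simpa using hx)
    have hy : y ∈ X := by rw [hXu]; simp
    have hc : (P ∪ {x})ᶜ = {y} ∪ Q := by
      ext w
      have := hmem w
      have h1 : w ∈ _ → w ∉ _ := fun hw => Finset.disjoint_left.1 hQX hw
      have h2 : w ∈ _ → w ∉ _ := fun hw => Finset.disjoint_left.1 hPX hw
      have h3 : w ∈ _ → w ∉ _ := fun hw => Finset.disjoint_left.1 hPQd hw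
      have h4 : w ∈ X ↔ w = x ∨ w = y := by rw [hXu]; simp
      have h5 : w = x → w ≠ y := by rintro rfl; simpa using hd
      simp only [Finset.mem_compl, Finset.mem_union, Finset.mem_singleton]; grind
    have := h (P ∪ {x}) ⟨u, by simp [huP]⟩ ⟨v, by rw [hc]; simp [hvQ]⟩
    have hyQ : Disjoint {y} Q := (hQX.mono_right (by simpa using hy)).symm
    rw [cutSize, hc, edgeCount_union_left _ _ hPx, edgeCount_union_right _ _ hyQ,
      edgeCount_union_right _ _ hyQ, hPQ] at this
    have h0 : edgeCount G {x} {y} ≤ edgeCount G X X :=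
      edgeCount_mono G (by simpa using hx) (by simpa using hy)
    omega
  have k1 := key x y hxX hXu hd
  have k2 := key y x hyX (by rw [hXu, Finset.union_comm]) hd.symm
  have d1 : edgeCount G P X = edgeCount G P {x} + edgeCount G P {y} := by
    rw [hXu, edgeCount_union_right _ _ hd]
  have d2 : edgeCount G Q X = edgeCount G {x} Q + edgeCount G {y} Q := by
    rw [hXu, edgeCount_union_right _ _ hd, edgeCount_comm G {x}, edgeCount_comm G {y}]
  have d3 : edgeCount G {x} X + edgeCount G P {x} + edgeCount G {x} Q = 3 := by
    have := hc.edgeCount_univ {x}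
    rw [← Finset.union_compl X, edgeCount_union_right _ _ disjoint_compl_right, hXc,
      edgeCount_union_right _ _ hPQd, edgeCount_comm G _ P] at this
    simp at this; omega
  have d4 : edgeCount G {x} X ≤ edgeCount G X X :=
    edgeCount_mono G (by simpa using hxX) subset_rfl
  omega

/-! ### Tutte barriers -/

/-- Tutte's theorem for the subgraph induced on `U`, with the odd components recorded as finsets of
`V` so that their edges can be counted in the whole graph. -/
theorem exists_matching_or_barrier {V : Type u} [Fintype V] [DecidableEq V] (G : SimpleGraph V)
    (U : Finset V) (hU : Even U.card) :
    (∃ f : V → V, ∀ u ∈ U, f u ∈ U ∧ G.Adj u (f u) ∧ f (f u) = u) ∨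
    ∃ X ⊆ U, ∃ 𝒟 : Finset (Finset V), (∀ D ∈ 𝒟, D ⊆ U \ X ∧ Odd D.card) ∧
      (∀ D ∈ 𝒟, ∀ D' ∈ 𝒟, D ≠ D' → Disjoint D D') ∧
      (∀ D ∈ 𝒟, ∀ a ∈ D, ∀ b ∈ U \ X, G.Adj a b → b ∈ D) ∧ X.card + 2 ≤ 𝒟.card := by
  classical
  set K := G.induce (U : Set V) with hK
  by_cases hM : ∃ M : K.Subgraph, M.IsPerfectMatching
  · left
    obtain ⟨M, hM⟩ := hM
    have hpm := isPM_of_isPerfectMatching hM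
    choose g hg hgu using hpm.2.2
    -- The value outside `U` is arbitrary.
    refine ⟨fun u => if hu : u ∈ (U : Set V) then (g ⟨u, hu⟩).1 else u, fun u hu => ?_⟩
    have hu' : u ∈ (U : Set V) := hu
    simp only [hu', dif_pos]
    refine ⟨(g ⟨u, hu⟩).2, hpm.2.1 _ _ (hg ⟨u, hu⟩), ?_⟩
    rw [dif_pos (g ⟨u, hu⟩).2]
    have := hgu (g ⟨u, hu⟩) ⟨u, hu⟩ (hpm.1 _ _ (hg _))
    exact congrArg Subtype.val this.symm
  · right
    rw [SimpleGraph.tutte] at hM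
    push Not at hM
    obtain ⟨u, hu⟩ := hM
    set L := ((⊤ : K.Subgraph).deleteVerts u).coe with hL
    let ι : ((⊤ : K.Subgraph).deleteVerts u).verts → V := fun w => w.1.1
    have hι : Function.Injective ι := Subtype.val_injective.comp Subtype.val_injective
    let F : L.ConnectedComponent → Finset V := fun c => (ι '' c.supp).toFinset
    have hF : ∀ c w, w ∈ F c ↔ ∃ p, L.connectedComponentMk p = c ∧ ι p = w := by
      intro c w; simp [F]
    have hFinj : ∀ c c' w, w ∈ F c → w ∈ F c' → c = c' := by
      intro c c' w hc hc'
      rw [hF] at hc hc'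
      obtain ⟨p, rfl, hp⟩ := hc
      obtain ⟨q, rfl, hq⟩ := hc'
      rw [hι (hp.trans hq.symm)]
    have hFne : ∀ c, (F c).Nonempty := by
      intro c
      obtain ⟨p, hp⟩ := c.exists_rep
      exact ⟨ι p, (hF _ _).2 ⟨p, hp, rfl⟩⟩
    have hFi : Function.Injective F := fun c c' h => by
      obtain ⟨w, hw⟩ := hFne c
      exact hFinj c c' w hw (h ▸ hw)
    set X : Finset V := (Subtype.val '' u).toFinset with hX
    have hXcard : X.card = u.ncard := by
      rw [hX, ← Set.ncard_eq_toFinset_card', Set.ncard_image_of_injective _ Subtype.val_injective]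
    have hmemι : ∀ p, ι p ∈ U \ X := by
      intro p
      rw [Finset.mem_sdiff]
      refine ⟨p.1.2, fun h => p.2.2 ?_⟩
      rw [hX, Set.mem_toFinset] at h
      obtain ⟨q, hq, hqe⟩ := h
      exact Subtype.val_injective hqe ▸ hq
    have hex : ∀ b ∈ U \ X, ∃ p, ι p = b := by
      intro b hb
      rw [Finset.mem_sdiff] at hb
      refine ⟨⟨⟨b, hb.1⟩, ⟨by trivial, fun h => hb.2 ?_⟩⟩, rfl⟩
      rw [hX, Set.mem_toFinset]
      exact ⟨_, h, rfl⟩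
    refine ⟨X, ?_, L.oddComponents.toFinset.image F, ?_, ?_, ?_, ?_⟩
    · intro w hw
      rw [hX, Set.mem_toFinset] at hw
      obtain ⟨q, -, rfl⟩ := hw
      exact q.2
    · intro D hD
      obtain ⟨c, hc, rfl⟩ := Finset.mem_image.1 hD
      rw [Set.mem_toFinset] at hc
      constructor
      · intro w hw
        obtain ⟨p, -, rfl⟩ := (hF _ _).1 hw
        exact hmemι p
      · have : (F c).card = c.supp.ncard := by
          rw [← Set.ncard_eq_toFinset_card', Set.ncard_image_of_injective _ hι]
        rw [this]; exact hc
    · intro D hD D' hD' hne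
      obtain ⟨c, hc, rfl⟩ := Finset.mem_image.1 hD
      obtain ⟨c', hc', rfl⟩ := Finset.mem_image.1 hD'
      rw [Finset.disjoint_left]
      intro w hw hw'
      exact hne (by rw [hFinj c c' w hw hw'])
    · intro D hD a ha b hb hab
      obtain ⟨c, hc, rfl⟩ := Finset.mem_image.1 hD
      obtain ⟨p, hp, rfl⟩ := (hF _ _).1 ha
      obtain ⟨q, rfl⟩ := hex b hb
      refine (hF _ _).2 ⟨q, ?_, rfl⟩
      rw [← hp, eq_comm, SimpleGraph.ConnectedComponent.eq]
      apply SimpleGraph.Adj.reachable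
      rw [hL, SimpleGraph.Subgraph.coe_adj, SimpleGraph.Subgraph.deleteVerts_adj]
      exact ⟨trivial, p.2.2, trivial, q.2.2, hab⟩
    · rw [Finset.card_image_of_injective _ hFi, hXcard, ← Set.ncard_eq_toFinset_card']
      have h1 : u.ncard < L.oddComponents.ncard := hu
      -- The number of odd components has the parity of |U| - |X|, hence of |X|; so an excess over
      -- |X| is at least 2.
      have h2 := L.odd_ncard_oddComponents
      have h3 : Nat.card ((⊤ : K.Subgraph).deleteVerts u).verts + X.card = U.card := by
        have e1 : Finset.univ.image ι = U \ X := by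
          ext b
          simp only [Finset.mem_image, Finset.mem_univ, true_and]
          exact ⟨fun ⟨p, hp⟩ => hp ▸ hmemι p, hex b⟩
        have e2 := Finset.card_image_of_injective Finset.univ hι
        rw [e1, Finset.card_univ] at e2
        rw [Nat.card_eq_fintype_card, ← e2]
        refine Finset.card_sdiff_add_card_eq_card ?_
        intro w hw
        rw [hX, Set.mem_toFinset] at hw
        obtain ⟨q, -, rfl⟩ := hw
        exact q.2
      rw [hXcard] at h3
      rw [Nat.odd_iff, Nat.odd_iff] at h2
      rw [Nat.even_iff] at hU
      omega

/-- A finite set closed under a fixed-point-free involution has even size. -/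
theorem even_card_of_involution {V : Type u} [DecidableEq V] (m : V → V) (hm : ∀ v, m (m v) = v)
    (hne : ∀ v, m v ≠ v) (S : Finset V) (hS : ∀ v ∈ S, m v ∈ S) : Even S.card := by
  have h := Finset.sum_involution (s := S) (f := fun _ => (1 : ZMod 2)) (fun a _ => m a)
    (fun a _ => by decide) (fun a _ _ => hne a) hS (fun a _ => hm a)
  simp only [Finset.sum_const, nsmul_eq_mul, mul_one] at h
  exact (ZMod.natCast_eq_zero_iff_even).1 h

/-- A perfect matching of `G`, as a function from vertices to their partners. -/
def IsMate {V : Type u} (G : SimpleGraph V) (m : V → V) : Prop :=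
  (∀ v, G.Adj v (m v)) ∧ ∀ v, m (m v) = v

theorem edgeCount_le_card {V : Type u} {G : SimpleGraph V} {A B : Finset V}
    (P : Finset (V × V)) (h : ∀ a ∈ A, ∀ b ∈ B, G.Adj a b → (a, b) ∈ P) :
    edgeCount G A B ≤ P.card := by
  classical
  rw [edgeCount, ← Finset.sum_product', ← Finset.card_filter]
  refine Finset.card_le_card fun p hp => ?_
  obtain ⟨h1, h2⟩ := Finset.mem_filter.1 hp
  obtain ⟨h3, h4⟩ := Finset.mem_product.1 h1
  exact h _ h3 _ h4 h2

/-- A perfect matching of `U` avoiding the edge `a`, `m a` could be glued to `m` outside `U`. The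
result would agree with `m` at `x` but not at `a`. So the barrier alternative holds after deleting
this edge. -/
theorem exists_barrier_of_unique {V : Type u} [Fintype V] [DecidableEq V] {G : SimpleGraph V}
    {m : V → V} (hm : IsMate G m) {x : V}
    (hu : ∀ m', IsMate G m' → m' x = m x → m' = m) (U : Finset V) (hxU : x ∉ U)
    (hmU : ∀ u ∈ U, m u ∈ U) {a : V} (ha : a ∈ U) :
    ∃ X ⊆ U, ∃ 𝒟 : Finset (Finset V), (∀ D ∈ 𝒟, D ⊆ U \ X ∧ Odd D.card) ∧
      (∀ D ∈ 𝒟, ∀ D' ∈ 𝒟, D ≠ D' → Disjoint D D') ∧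
      (∀ D ∈ 𝒟, ∀ p ∈ D, ∀ q ∈ U \ X, G.Adj p q → q ∈ D ∨ s(p, q) = s(a, m a)) ∧
      X.card + 2 ≤ 𝒟.card := by
  have heven := even_card_of_involution m hm.2 (fun v => (hm.1 v).ne') U hmU
  rcases exists_matching_or_barrier (G.deleteEdges {s(a, m a)}) U heven with ⟨f, hf⟩ | h
  · exfalso
    have hmate : IsMate G (fun u => if u ∈ U then f u else m u) := by
      refine ⟨fun v => ?_, fun v => ?_⟩
      · by_cases hv : v ∈ U
        · simp only [hv, if_true]
          exact (SimpleGraph.deleteEdges_adj.1 (hf v hv).2.1).1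
        · simpa only [hv, if_false] using hm.1 v
      · by_cases hv : v ∈ U
        · simp only [hv, if_true, (hf v hv).1, (hf v hv).2.2]
        · have hv' : m v ∉ U := fun h => hv (by simpa [hm.2] using hmU _ h)
          simp only [hv, if_false, hv', hm.2]
    have h1 := congrFun (hu _ hmate (by simp [hxU])) a
    simp only [ha, if_true] at h1
    have h2 := (hf a ha).2.1
    rw [h1] at h2
    simp [SimpleGraph.deleteEdges_adj] at h2
  · obtain ⟨X, hX, 𝒟, h1, h2, h3, h4⟩ := h
    refine ⟨X, hX, 𝒟, h1, h2, fun D hD p hp q hq hpq => ?_, h4⟩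
    by_cases he : s(p, q) = s(a, m a)
    · exact Or.inr he
    · exact Or.inl (h3 D hD p hp q hq (SimpleGraph.deleteEdges_adj.2 ⟨hpq, by simpa using he⟩))

/-! ### Tight barriers and the triangle on a matching edge -/

/-- The structure of a barrier of a set with four leaving edges in a cubic graph all of whose
cuts have at least three edges, after the removal of a matching edge. -/
theorem exists_tight_barrier {V : Type u} [Fintype V] [DecidableEq V] {G : SimpleGraph V}
    (hc : IsCubic G) (hG : CutsGeThree G) {m : V → V} (hm : IsMate G m) {x : V}
    (hu : ∀ m', IsMate G m' → m' x = m x → m' = m) (U : Finset V) (hxU : x ∉ U)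
    (hmU : ∀ u ∈ U, m u ∈ U) (hcut : cutSize G U = 4) {a : V} (ha : a ∈ U) :
    ∃ X ⊆ U, ∃ 𝒟 : Finset (Finset V),
      (∀ D ∈ 𝒟, D ⊆ U \ X ∧ Odd D.card ∧ cutSize G D = 3) ∧
      (∀ u ∈ U \ X, ∃ D ∈ 𝒟, u ∈ D) ∧
      (∀ D ∈ 𝒟, ∀ p ∈ D, ∀ q ∈ U \ X, G.Adj p q → q ∈ D ∨ s(p, q) = s(a, m a)) ∧
      (∀ p ∈ X, ∀ q, G.Adj p q → q ∈ U \ X) ∧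
      𝒟.card = X.card + 2 ∧ a ∉ X ∧ m a ∉ X ∧
      (∀ D ∈ 𝒟, ∃ t ∈ D, m t ∉ D ∧ ∀ v ∈ D, v ≠ t → m v ∈ D) := by
  obtain ⟨X, hXU, 𝒟, hD, hdis, hadj, hcard⟩ := exists_barrier_of_unique hm hu U hxU hmU ha
  set Z := 𝒟.biUnion id with hZ
  have hmemZ : ∀ {u}, u ∈ Z ↔ ∃ D ∈ 𝒟, u ∈ D := by intro u; simp [hZ]
  have hZU : Z ⊆ U \ X := by
    intro u hu
    obtain ⟨D, hD', hu⟩ := hmemZ.1 hu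
    exact (hD D hD').1 hu
  set R := (U \ X) \ Z with hR
  have hDne : ∀ D ∈ 𝒟, D.Nonempty := fun D h => Finset.card_pos.1 (hD D h).2.pos
  have hdisj : (𝒟 : Set (Finset V)).PairwiseDisjoint id := fun D h D' h' hne => hdis D h D' h' hne
  have dXUc : Disjoint X Uᶜ := Finset.disjoint_left.2 fun w hw => by simpa using hXU hw
  have dZR : Disjoint Z R := Finset.disjoint_sdiff
  have hUX : U \ X = Z ∪ R := by rw [hR, Finset.union_sdiff_of_subset hZU]
  have hU : U = X ∪ (Z ∪ R) := by rw [← hUX, Finset.union_sdiff_of_subset hXU]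
  have dXZR : Disjoint X (Z ∪ R) := by rw [← hUX]; exact Finset.disjoint_sdiff
  have sumZ : ∀ B, ∑ D ∈ 𝒟, edgeCount G D B = edgeCount G Z B := fun B => by
    rw [edgeCount, hZ, Finset.sum_biUnion hdisj]; rfl
  -- edges between different members of the family
  have hε : ∀ D ∈ 𝒟, edgeCount G D ((U \ X) \ D) ≤
      (if a ∈ D then 1 else 0) + (if m a ∈ D then 1 else 0) := by
    intro D hD'
    classical
    have : edgeCount G D ((U \ X) \ D) ≤
        ∑ p ∈ D, ((if a = p then 1 else 0) + (if m a = p then 1 else 0)) := by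
      rw [edgeCount_eq_sum]
      refine Finset.sum_le_sum fun p hp => ?_
      have hsub : ((U \ X) \ D).filter (G.Adj p) ⊆
          (if a = p then {m a} else ∅) ∪ (if m a = p then {a} else ∅) := by
        intro q hq
        obtain ⟨hq1, hq2⟩ := Finset.mem_filter.1 hq
        obtain ⟨hq3, hq4⟩ := Finset.mem_sdiff.1 hq1
        have h := (hadj D hD' p hp q hq3 hq2).resolve_left hq4
        rw [Sym2.eq_iff] at h
        rcases h with ⟨rfl, rfl⟩ | ⟨rfl, rfl⟩ <;> simp
      refine (Finset.card_le_card hsub).trans ((Finset.card_union_le _ _).trans ?_)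
      refine add_le_add ?_ ?_ <;> split_ifs <;> simp
    refine this.trans_eq ?_
    rw [Finset.sum_add_distrib, Finset.sum_ite_eq, Finset.sum_ite_eq]
  have hsplit : ∀ D ∈ 𝒟, cutSize G D = edgeCount G D X + edgeCount G D Uᶜ +
      edgeCount G D ((U \ X) \ D) := by
    intro D hD'
    have hsub := (hD D hD').1
    have e : Dᶜ = (X ∪ Uᶜ) ∪ ((U \ X) \ D) := by
      ext w
      have h1 : w ∈ D → w ∈ U \ X := fun h => hsub h
      have h2 : w ∈ X → w ∈ U := fun h => hXU h
      simp only [Finset.mem_compl, Finset.mem_union, Finset.mem_sdiff] at *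
      tauto
    have d : Disjoint (X ∪ Uᶜ) ((U \ X) \ D) := by
      rw [Finset.disjoint_left]
      intro w
      simp only [Finset.mem_compl, Finset.mem_union, Finset.mem_sdiff]
      tauto
    rw [cutSize, e, edgeCount_union_right _ _ d, edgeCount_union_right _ _ dXUc]
  have one : ∀ b, ∑ D ∈ 𝒟, (if b ∈ D then 1 else 0) ≤ if b ∈ Z then 1 else 0 := by
    intro b
    rw [← Finset.card_filter]
    split_ifs with hb
    · rw [Finset.card_le_one]
      intro D hD' D' hD''
      rw [Finset.mem_filter] at hD' hD''
      by_contra hne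
      exact Finset.disjoint_left.1 (hdis D hD'.1 D' hD''.1 hne) hD'.2 hD''.2
    · rw [Nat.le_zero, Finset.card_eq_zero, Finset.filter_eq_empty_iff]
      exact fun D hD' hbD => hb (hmemZ.2 ⟨D, hD', hbD⟩)
  have hsumε : ∑ D ∈ 𝒟, edgeCount G D ((U \ X) \ D) ≤
      (if a ∈ Z then 1 else 0) + (if m a ∈ Z then 1 else 0) := by
    refine (Finset.sum_le_sum hε).trans ?_
    rw [Finset.sum_add_distrib]
    exact add_le_add (one a) (one (m a))
  have hcut3 : ∀ D ∈ 𝒟, 3 ≤ cutSize G D := fun D h => hG D (hDne D h)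
    ⟨x, Finset.mem_compl.2 fun hx => hxU (Finset.mem_sdiff.1 ((hD D h).1 hx)).1⟩
  have htot : ∑ D ∈ 𝒟, cutSize G D = edgeCount G Z X + edgeCount G Z Uᶜ +
      ∑ D ∈ 𝒟, edgeCount G D ((U \ X) \ D) := by
    rw [Finset.sum_congr rfl hsplit, Finset.sum_add_distrib, Finset.sum_add_distrib, sumZ, sumZ]
  have hlow : 3 * 𝒟.card ≤ ∑ D ∈ 𝒟, cutSize G D := by
    rw [mul_comm]; exact Finset.card_nsmul_le_sum _ _ _ hcut3
  have hXsum : edgeCount G X X + (edgeCount G X Z + edgeCount G X R) + edgeCount G X Uᶜ =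
      3 * X.card := by
    rw [← hc.edgeCount_univ X, ← Finset.union_compl U, edgeCount_union_right _ _ disjoint_compl_right]
    conv_rhs => rw [hU]
    rw [edgeCount_union_right _ _ dXZR, edgeCount_union_right _ _ dZR, ← hU]
  have hUsum : edgeCount G X Uᶜ + (edgeCount G Z Uᶜ + edgeCount G R Uᶜ) = 4 := by
    rw [← hcut, cutSize]
    conv_rhs => rw [hU]
    rw [edgeCount_union_left _ _ dXZR, edgeCount_union_left _ _ dZR, ← hU]
  have hZX := edgeCount_comm G Z X
  -- All estimates are tight: 3(|X| + 2) ≤ 3|𝒟| ≤ sum of the cuts ≤ 3|X| + 4 + 2. Here 3|X| bounds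
  -- the edges to `X`, 4 those leaving `U`, and 2 counts the edge `a`, `m a` from both ends.
  have haZ : a ∈ Z := by
    by_contra h; rw [if_neg h] at hsumε; split_ifs at hsumε <;> omega
  have hmaZ : m a ∈ Z := by
    by_contra h; rw [if_neg h] at hsumε; split_ifs at hsumε; omega
  rw [if_pos haZ, if_pos hmaZ] at hsumε
  have hcard' : 𝒟.card = X.card + 2 := by omega
  have hXX : edgeCount G X X = 0 := by omega
  have hXUc : edgeCount G X Uᶜ = 0 := by omega
  have hXR : edgeCount G X R = 0 := by omega
  have hRUc : edgeCount G R Uᶜ = 0 := by omega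
  have hsum3 : ∑ D ∈ 𝒟, 3 = ∑ D ∈ 𝒟, cutSize G D := by
    rw [Finset.sum_const, smul_eq_mul]; omega
  have hD3 := (Finset.sum_eq_sum_iff_of_le hcut3).1 hsum3
  -- No edge leaves `R`, so a nonempty `R` would have an empty cut.
  have hRe : R = ∅ := by
    by_contra hne
    have h3 := hG R (Finset.nonempty_iff_ne_empty.2 hne)
      ⟨x, Finset.mem_compl.2 fun hx => hxU (Finset.mem_sdiff.1 (Finset.mem_sdiff.1 hx).1).1⟩
    have h0 : cutSize G R = 0 := by
      rw [cutSize, edgeCount_eq_zero_iff]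
      intro p hp q hq hpq
      by_cases hqU : q ∈ U
      · rw [hU, Finset.mem_union, Finset.mem_union] at hqU
        rcases hqU with hqX | hqZ | hqR
        · exact edgeCount_eq_zero_iff.1 hXR q hqX p hp hpq.symm
        · obtain ⟨D, hD', hqD⟩ := hmemZ.1 hqZ
          have hpR := Finset.mem_sdiff.1 hp
          rcases hadj D hD' q hqD p hpR.1 hpq.symm with h | h
          · exact hpR.2 (hmemZ.2 ⟨D, hD', h⟩)
          · rw [Sym2.eq_iff] at h
            rcases h with ⟨-, rfl⟩ | ⟨-, rfl⟩
            · exact hpR.2 hmaZ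
            · exact hpR.2 haZ
        · exact Finset.mem_compl.1 hq hqR
      · exact edgeCount_eq_zero_iff.1 hRUc p hp q (Finset.mem_compl.2 hqU) hpq
    omega
  have hcross : ∀ D ∈ 𝒟, ∃ t ∈ D, m t ∉ D := by
    intro D hD'
    by_contra! h
    have := even_card_of_involution m hm.2 (fun v => (hm.1 v).ne') D h
    exact (Nat.not_even_iff_odd.2 (hD D hD').2) this
  refine ⟨X, hXU, 𝒟, fun D h => ⟨(hD D h).1, (hD D h).2, (hD3 D h).symm⟩, ?_, hadj, ?_, hcard',
    (Finset.mem_sdiff.1 (hZU haZ)).2, (Finset.mem_sdiff.1 (hZU hmaZ)).2, ?_⟩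
  · intro v hv
    rw [hUX, hRe, Finset.union_empty] at hv
    exact hmemZ.1 hv
  · intro p hp q hpq
    rw [Finset.mem_sdiff]
    refine ⟨?_, fun hq => edgeCount_eq_zero_iff.1 hXX p hp q hq hpq⟩
    by_contra hq
    exact edgeCount_eq_zero_iff.1 hXUc p hp q (Finset.mem_compl.2 hq) hpq
  · have : Nonempty V := ⟨x⟩
    choose! t ht1 ht2 using hcross
    intro D0 hD0
    refine ⟨t D0, ht1 D0 hD0, ht2 D0 hD0, fun v hv hvt => ?_⟩
    by_contra hmv
    -- Vertices matched out of their member lie in a set of size at most |X| + 2 = |𝒟|. By parity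
    -- every member contains one, so a second one in `D0` is one too many.
    have hW : ∀ D ∈ 𝒟, ∀ w ∈ D, m w ∉ D → w ∈ X.image m ∪ {a, m a} := by
      intro D hD' w hw hmw
      have hwU := Finset.mem_sdiff.1 ((hD D hD').1 hw)
      rw [Finset.mem_union]
      by_cases hX' : m w ∈ X
      · exact Or.inl (Finset.mem_image.2 ⟨m w, hX', hm.2 w⟩)
      · right
        have h := (hadj D hD' w hw (m w) (Finset.mem_sdiff.2 ⟨hmU w hwU.1, hX'⟩)
          (hm.1 w)).resolve_left hmw
        rw [Sym2.eq_iff] at h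
        rcases h with ⟨h, -⟩ | ⟨h, -⟩ <;> simp [h]
    have hsame : ∀ D ∈ 𝒟, ∀ D' ∈ 𝒟, ∀ w, w ∈ D → w ∈ D' → D = D' := by
      intro D hD' D' hD'' w hw hw'
      by_contra hne
      exact Finset.disjoint_left.1 (hdis D hD' D' hD'' hne) hw hw'
    have hinj : Set.InjOn t (𝒟 : Set (Finset V)) := fun D hD' D' hD'' h =>
      hsame D hD' D' hD'' (t D) (ht1 D hD') (h ▸ ht1 D' hD'')
    have hv' : v ∉ 𝒟.image t := by
      intro h
      obtain ⟨D, hD', rfl⟩ := Finset.mem_image.1 h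
      rw [hsame D hD' D0 hD0 _ (ht1 D hD') hv] at hvt
      exact hvt rfl
    have hsub : insert v (𝒟.image t) ⊆ X.image m ∪ {a, m a} := by
      intro w hw
      rcases Finset.mem_insert.1 hw with rfl | hw
      · exact hW D0 hD0 _ hv hmv
      · obtain ⟨D, hD', rfl⟩ := Finset.mem_image.1 hw
        exact hW D hD' _ (ht1 D hD') (ht2 D hD')
    have h1 := Finset.card_le_card hsub
    rw [Finset.card_insert_of_notMem hv', Finset.card_image_of_injOn hinj] at h1
    have h2 := Finset.card_union_le (X.image m) {a, m a}
    have h3 : (X.image m).card ≤ X.card := Finset.card_image_le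
    have h4 : ({a, m a} : Finset V).card ≤ 2 := Finset.card_le_two
    omega

/-- In a set with three leaving edges, one of them in the matching, there is a triangle
that contains a matching edge. -/
theorem exists_triangle_of_cut {V : Type u} [Fintype V] [DecidableEq V] {G : SimpleGraph V}
    (hc : IsCubic G) (hG : CutsGeThree G) {m : V → V} (hm : IsMate G m) {x : V}
    (hu : ∀ m', IsMate G m' → m' x = m x → m' = m) (n : ℕ) :
    ∀ (S : Finset V) (s : V), S.card = n → 3 ≤ S.card → x ∉ S → s ∈ S → m s ∉ S →
      (∀ v ∈ S, v ≠ s → m v ∈ S) → cutSize G S = 3 →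
      ∃ a c, G.Adj a c ∧ G.Adj (m a) c := by
  induction n using Nat.strong_induction_on with
  | _ n ih =>
  intro S s hn hS3 hxS hs hms hmS hcutS
  set U := S.erase s with hU
  have hUS : U ⊆ S := Finset.erase_subset _ _
  have hxU : x ∉ U := fun h => hxS (hUS h)
  have hsU : s ∉ U := Finset.notMem_erase s S
  have hUcard : U.card + 1 = S.card := Finset.card_erase_add_one hs
  have hmU : ∀ v ∈ U, m v ∈ U := by
    intro v hv
    obtain ⟨h1, h2⟩ := Finset.mem_erase.1 hv
    refine Finset.mem_erase.2 ⟨?_, hmS v h2 h1⟩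
    rintro rfl
    exact hms (by rwa [hm.2])
  have hSu : S = {s} ∪ U := (Finset.insert_erase hs).symm
  have hdsU : Disjoint {s} U := by simpa using hsU
  have hUne : U.Nonempty := Finset.card_pos.1 (by omega)
  have e1 : edgeCount G {s} Sᶜ + edgeCount G U Sᶜ = 3 := by
    rw [← hcutS, cutSize]
    conv_rhs => rw [hSu]
    rw [edgeCount_union_left _ _ hdsU, ← hSu]
  have e2 : edgeCount G {s} U + edgeCount G {s} Sᶜ = 3 := by
    have h := hc.edgeCount_univ {s}
    have hd : Disjoint S Sᶜ := disjoint_compl_right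
    rw [← Finset.union_compl S, edgeCount_union_right _ _ hd] at h
    conv at h => lhs; lhs; rw [hSu]
    rw [edgeCount_union_right _ _ hdsU, Finset.card_singleton] at h
    have : edgeCount G {s} {s} = 0 := by rw [edgeCount_eq_zero_iff]; simp
    omega
  have e3 : cutSize G U = edgeCount G {s} U + edgeCount G U Sᶜ := by
    have : Uᶜ = {s} ∪ Sᶜ := by
      ext w; simp only [hU, Finset.mem_compl, Finset.mem_erase, Finset.mem_union,
        Finset.mem_singleton]; tauto
    rw [cutSize, this, edgeCount_union_right, edgeCount_comm G U {s}]
    simpa using hs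
  -- If `s` sends k edges into `U`, it sends 3 - k out of `S`, so the cut of `U` has k + (3 - (3 -
  -- k)) = 2k edges. Since `m s` lies outside `S`, k ≤ 2, and 2k ≥ 3 leaves k = 2.
  have e4 : 1 ≤ edgeCount G {s} Sᶜ := by
    rw [Nat.one_le_iff_ne_zero, Ne, edgeCount_eq_zero_iff]
    intro h
    exact h s (by simp) (m s) (by simpa using hms) (hm.1 s)
  have e5 := hG U hUne ⟨s, by simpa using hsU⟩
  have hcutU : cutSize G U = 4 := by omega
  have hsU2 : edgeCount G {s} U = 2 := by omega
  -- recursion into a member of a barrier family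
  have hrec : ∀ D : Finset V, D ⊆ U → 3 ≤ D.card → cutSize G D = 3 →
      (∃ t ∈ D, m t ∉ D ∧ ∀ v ∈ D, v ≠ t → m v ∈ D) → ∃ a c, G.Adj a c ∧ G.Adj (m a) c := by
    rintro D hDU hD3 hDcut ⟨t, ht, hmt, htD⟩
    have := Finset.card_le_card hDU
    exact ih D.card (by omega) D t rfl hD3 (fun h => hxU (hDU h)) ht hmt htD hDcut
  by_contra hno
  obtain ⟨a, ha⟩ := hUne
  -- Without a triangle, the recursion forces all members to be single vertices. Thus `U` is
  -- bipartite with parts `X` and `U \ X`, up to the edge `a`, `m a`.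
  have hbar : ∀ a ∈ U, ∃ X ⊆ U, (∀ p ∈ U \ X, ∀ q ∈ U \ X, G.Adj p q → s(p, q) = s(a, m a)) ∧
      (∀ p ∈ X, ∀ q, G.Adj p q → q ∈ U \ X) ∧ (U \ X).card = X.card + 2 ∧
      a ∉ X ∧ m a ∉ X := by
    intro a ha
    obtain ⟨X, hXU, 𝒟, hD, hcov, hadj, hX, hcard, haX, hmaX, hcr⟩ :=
      exists_tight_barrier hc hG hm hu U hxU hmU hcutU ha
    have hone : ∀ D ∈ 𝒟, D.card = 1 := by
      intro D hD'
      by_contra h1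
      obtain ⟨hsub, ⟨k, hk⟩, hD3⟩ := hD D hD'
      exact hno (hrec D (hsub.trans Finset.sdiff_subset) (by omega) hD3 (hcr D hD'))
    refine ⟨X, hXU, ?_, hX, ?_, haX, hmaX⟩
    · intro p hp q hq hpq
      obtain ⟨D, hD', hpD⟩ := hcov p hp
      refine (hadj D hD' p hpD q hq hpq).resolve_left fun hqD => hpq.ne ?_
      exact Finset.card_le_one.1 (hone D hD').le p hpD q hqD
    · have hdisj : (𝒟 : Set (Finset V)).PairwiseDisjoint id := by
        intro D hD' D' hD'' hne
        obtain ⟨p, rfl⟩ := Finset.card_eq_one.1 (hone D hD')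
        obtain ⟨q, rfl⟩ := Finset.card_eq_one.1 (hone D' hD'')
        exact Finset.disjoint_singleton.2 fun h => hne (by rw [h])
      have : U \ X = 𝒟.biUnion id := by
        ext v
        simp only [Finset.mem_biUnion, id]
        exact ⟨hcov v, fun ⟨D, hD', hv⟩ => (hD D hD').1 hv⟩
      rw [this, Finset.card_biUnion hdisj, ← hcard]
      simpa using Finset.sum_congr rfl hone
  obtain ⟨X, hXU, hZ, hX, hXcard, haX, hmaX⟩ := hbar a ha
  rcases X.eq_empty_or_nonempty with rfl | ⟨y, hy⟩
  · rw [Finset.sdiff_empty, Finset.card_empty, zero_add] at hXcard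
    have hUa : U = {a, m a} := by
      symm
      refine Finset.eq_of_subset_of_card_le ?_ ?_
      · intro v hv
        rcases Finset.mem_insert.1 hv with rfl | hv
        · exact ha
        · rw [Finset.mem_singleton.1 hv]; exact hmU a ha
      · rw [hXcard, Finset.card_pair (hm.1 a).ne]
    classical
    rw [edgeCount_singleton_left, ← hXcard, Finset.card_filter_eq_iff] at hsU2
    exact hno ⟨a, s, (hsU2 a ha).symm, (hsU2 _ (hmU a ha)).symm⟩
  -- The barrier for the edge at `y` misses `y`, so it differs from `X`; the symmetric difference
  -- `Y` will have too small a cut.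
  · obtain ⟨X', hXU', hZ', hX', -, hyX', hmyX'⟩ := hbar y (hXU hy)
    set Y := (X \ X') ∪ (X' \ X) with hY
    have hYU : Y ⊆ U := Finset.union_subset (Finset.sdiff_subset.trans hXU)
      (Finset.sdiff_subset.trans hXU')
    have h3 := hG Y ⟨y, by simp [hY, hy, hyX']⟩ ⟨s, by simpa using fun h => hsU (hYU h)⟩
    -- Of the two orientations of the edge `a`, `m a`, only one can start in `X'`, which spans no
    -- edge.
    obtain ⟨p, hp⟩ : ∃ p : V × V, ∀ u ∈ X' \ X, ∀ w ∈ U \ X, s(u, w) = s(a, m a) → (u, w) = p := by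
      by_cases haX' : a ∈ X'
      · refine ⟨(a, m a), fun u hu w hw h => ?_⟩
        rw [Sym2.eq_iff] at h
        rcases h with ⟨rfl, rfl⟩ | ⟨rfl, rfl⟩
        · rfl
        · exact absurd (Finset.mem_sdiff.1 hu).1 (Finset.mem_sdiff.1 (hX' _ haX' _ (hm.1 _))).2
      · refine ⟨(m a, a), fun u hu w hw h => ?_⟩
        rw [Sym2.eq_iff] at h
        rcases h with ⟨rfl, rfl⟩ | ⟨rfl, rfl⟩
        · exact absurd (Finset.mem_sdiff.1 hu).1 haX'
        · rfl
    have h2 : cutSize G Y ≤ ({(y, m y), p} : Finset (V × V)).card := by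
      refine edgeCount_le_card _ fun u hu w hw huw => ?_
      rw [hY, Finset.mem_compl, Finset.mem_union, Finset.mem_sdiff, Finset.mem_sdiff] at hw
      rw [Finset.mem_insert, Finset.mem_singleton]
      rcases Finset.mem_union.1 hu with h | h
      -- An edge from `X \ X'` out of `Y` ends outside both barriers, so neither end is in `X'` and
      -- it is the edge `y`, `m y`. The other case is symmetric, with `p`.
      · obtain ⟨h1, h2⟩ := Finset.mem_sdiff.1 h
        obtain ⟨hwU, hwX⟩ := Finset.mem_sdiff.1 (hX u h1 w huw)
        have hwX' : w ∉ X' := by tauto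
        have he := hZ' u (Finset.mem_sdiff.2 ⟨hXU h1, h2⟩) w (Finset.mem_sdiff.2 ⟨hwU, hwX'⟩) huw
        rw [Sym2.eq_iff] at he
        rcases he with ⟨rfl, rfl⟩ | ⟨-, rfl⟩
        · exact Or.inl rfl
        · exact absurd hy hwX
      · obtain ⟨h1, h2⟩ := Finset.mem_sdiff.1 h
        obtain ⟨hwU, hwX'⟩ := Finset.mem_sdiff.1 (hX' u h1 w huw)
        have hwX : w ∉ X := by tauto
        have hw' := Finset.mem_sdiff.2 ⟨hwU, hwX⟩
        exact Or.inr (hp u h w hw' (hZ u (Finset.mem_sdiff.2 ⟨hXU' h1, h2⟩) w hw' huw))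
    have h4 : ({(y, m y), p} : Finset (V × V)).card ≤ 2 := Finset.card_le_two
    omega

/-- If `m` is the only perfect matching that contains the edge of `m` at `x`, then some triangle
contains an edge of `m`. -/
theorem exists_triangle_of_unique {V : Type u} [Fintype V] [DecidableEq V] {G : SimpleGraph V}
    (hc : IsCubic G) (hG : CutsGeThree G) {m : V → V} (hm : IsMate G m) {x : V}
    (hu : ∀ m', IsMate G m' → m' x = m x → m' = m) :
    ∃ a c, G.Adj a c ∧ G.Adj (m a) c := by
  have hcard : 3 < Fintype.card V := by
    have : Nonempty V := ⟨x⟩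
    rw [← Nat.card_eq_fintype_card]; exact hc.three_lt_card
  have hxc : ({x}ᶜ : Finset V).card = Fintype.card V - 1 := by
    rw [Finset.card_compl, Finset.card_singleton]
  -- The complement of `x` has three leaving edges, and the only matching edge among them ends at `m
  -- x`.
  refine exists_triangle_of_cut hc hG hm hu _ {x}ᶜ (m x) rfl (by omega) (by simp)
    (by simpa using (hm.1 x).ne') (by simp [hm.2]) ?_ ?_
  · intro v _ hne
    rw [Finset.mem_compl, Finset.mem_singleton]
    rintro h
    exact hne (by rw [← h, hm.2])
  · have h := hc.edgeCount_add_cutSize {x}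
    have h0 : edgeCount G {x} {x} = 0 := by rw [edgeCount_eq_zero_iff]; simp
    rw [cutSize, edgeCount_comm, compl_compl]
    rw [cutSize, Finset.card_singleton] at h
    omega

/-! ### Degrees and cuts under replacement by a triangle -/

/-- The map from `replaceByTriangle G v` to `G` that collapses the triangle. -/
def collapse {V : Type u} (G : SimpleGraph V) (v : V) :
    ({w : V // w ≠ v} ⊕ {x : V // G.Adj v x}) → V :=
  Sum.elim (fun a => a.1) (fun _ => v)

section

variable {V : Type u} {G : SimpleGraph V} {v : V}

@[simp] theorem collapse_inl (a : {w : V // w ≠ v}) : collapse G v (Sum.inl a) = a.1 := rfl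

@[simp] theorem collapse_inr (x : {x : V // G.Adj v x}) : collapse G v (Sum.inr x) = v := rfl

@[simp] theorem replaceByTriangle_adj_inl_inr {a : {w : V // w ≠ v}} {x : {x : V // G.Adj v x}} :
    (replaceByTriangle G v).Adj (Sum.inl a) (Sum.inr x) ↔ a.1 = x.1 := Iff.rfl

@[simp] theorem replaceByTriangle_adj_inr_inl {a : {w : V // w ≠ v}} {x : {x : V // G.Adj v x}} :
    (replaceByTriangle G v).Adj (Sum.inr x) (Sum.inl a) ↔ a.1 = x.1 := Iff.rfl

@[simp] theorem replaceByTriangle_adj_inr_inr {x y : {x : V // G.Adj v x}} :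
    (replaceByTriangle G v).Adj (Sum.inr x) (Sum.inr y) ↔ x ≠ y := Iff.rfl

theorem collapse_injOn (a : {w : V // w ≠ v}) :
    Set.InjOn (collapse G v) ((replaceByTriangle G v).neighborSet (Sum.inl a)) := by
  rintro (p | p) hp (q | q) hq h
  · exact congrArg Sum.inl (Subtype.ext h)
  · exact absurd h p.2
  · exact absurd h.symm q.2
  · have h1 : a.1 = p.1 := hp
    have h2 : a.1 = q.1 := hq
    exact congrArg Sum.inr (Subtype.ext (h1.symm.trans h2))

theorem collapse_image_neighborSet (a : {w : V // w ≠ v}) :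
    collapse G v '' ((replaceByTriangle G v).neighborSet (Sum.inl a)) = G.neighborSet a.1 := by
  ext b
  simp only [Set.mem_image, SimpleGraph.mem_neighborSet]
  constructor
  · rintro ⟨p | p, hp, rfl⟩
    · exact hp
    · have h : a.1 = p.1 := hp
      simpa [h] using p.2.symm
  · intro hb
    by_cases h : b = v
    · subst h
      exact ⟨Sum.inr ⟨a.1, hb.symm⟩, rfl, rfl⟩
    · exact ⟨Sum.inl ⟨b, h⟩, hb, rfl⟩

theorem ncard_neighborSet_inl (a : {w : V // w ≠ v}) :
    ((replaceByTriangle G v).neighborSet (Sum.inl a)).ncard = (G.neighborSet a.1).ncard := by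
  rw [← collapse_image_neighborSet, (collapse_injOn a).ncard_image]

theorem ncard_neighborSet_inr (hf : (G.neighborSet v).Finite) (x : {x : V // G.Adj v x}) :
    ((replaceByTriangle G v).neighborSet (Sum.inr x)).ncard = (G.neighborSet v).ncard := by
  have hfin : Finite {x : V // G.Adj v x} := hf
  have h : (replaceByTriangle G v).neighborSet (Sum.inr x) =
      insert (Sum.inl ⟨x.1, x.2.ne'⟩) (Sum.inr '' {x}ᶜ) := by
    ext (a | y)
    · simp [Subtype.ext_iff]
    · simp [eq_comm]
  have h1 : ({x} : Set {x : V // G.Adj v x}).ncard + ({x}ᶜ : Set {x : V // G.Adj v x}).ncard =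
      Nat.card {x : V // G.Adj v x} := Set.ncard_add_ncard_compl _
  have h2 : Nat.card {x : V // G.Adj v x} = (G.neighborSet v).ncard := rfl
  rw [h, Set.ncard_insert_of_notMem (by simp) ((Set.toFinite _).image _),
    Set.ncard_image_of_injective _ Sum.inr_injective]
  rw [Set.ncard_singleton] at h1
  omega

theorem IsCubic.replaceByTriangle (h : IsCubic G) (v : V) :
    IsCubic (replaceByTriangle G v) := by
  rintro (a | x)
  · rw [ncard_neighborSet_inl, h]
  · rw [ncard_neighborSet_inr (Set.finite_of_ncard_ne_zero (by rw [h v]; simp)), h]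

theorem isCubic_of_replaceByTriangle (h : IsCubic (replaceByTriangle G v))
    (hv : (G.neighborSet v).ncard = 3) : IsCubic G := by
  intro w
  by_cases hw : w = v
  · rw [hw, hv]
  · rw [← ncard_neighborSet_inl ⟨w, hw⟩, h]

theorem exists_collapse_eq (hv : (G.neighborSet v).Nonempty) (w : V) :
    ∃ p, collapse G v p = w := by
  by_cases h : w = v
  · obtain ⟨x, hx⟩ := hv
    exact ⟨Sum.inr ⟨x, hx⟩, h.symm⟩
  · exact ⟨Sum.inl ⟨w, h⟩, rfl⟩

theorem edgeCount_inl_preimage [DecidableEq V]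
    [Fintype ({w : V // w ≠ v} ⊕ {x : V // G.Adj v x})] (a : {w : V // w ≠ v}) (B : Finset V) :
    edgeCount (replaceByTriangle G v) {Sum.inl a} (Finset.univ.filter (collapse G v · ∈ B)) =
      edgeCount G {a.1} B := by
  classical
  rw [edgeCount_singleton_left, edgeCount_singleton_left,
    ← Finset.card_image_of_injOn (f := collapse G v)]
  · congr 1
    ext b
    have := Set.ext_iff.1 (collapse_image_neighborSet (G := G) a) b
    simp only [Set.mem_image, SimpleGraph.mem_neighborSet] at this
    simp only [Finset.mem_image, Finset.mem_filter, Finset.mem_univ, true_and]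
    rw [← this]
    grind
  · refine (collapse_injOn (G := G) a).mono ?_
    intro p hp
    simp only [Finset.coe_filter, Set.mem_ofPred_eq] at hp
    exact hp.2

/-- Edges with an end outside the triangle correspond to the edges of `G`. The condition `v ∉ A`
excludes the triangle edges, which collapse to a point. -/
theorem edgeCount_preimage [DecidableEq V]
    [Fintype ({w : V // w ≠ v} ⊕ {x : V // G.Adj v x})] (A B : Finset V) (hA : v ∉ A) :
    edgeCount (replaceByTriangle G v) (Finset.univ.filter (collapse G v · ∈ A))
      (Finset.univ.filter (collapse G v · ∈ B)) = edgeCount G A B := by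
  rw [edgeCount_sum_left, edgeCount_sum_left G]
  refine Finset.sum_bij (fun p _ => collapse G v p) ?_ ?_ ?_ ?_
  · intro p hp; exact (Finset.mem_filter.1 hp).2
  · rintro (p | p) hp (q | q) hq h
    · exact congrArg Sum.inl (Subtype.ext h)
    · exact absurd (Finset.mem_filter.1 hq).2 hA
    · exact absurd (Finset.mem_filter.1 hp).2 hA
    · exact absurd (Finset.mem_filter.1 hp).2 hA
  · intro b hb
    exact ⟨Sum.inl ⟨b, fun h => hA (h ▸ hb)⟩, by simpa using hb, rfl⟩
  · rintro (p | p) hp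
    · exact edgeCount_inl_preimage p B
    · exact absurd (Finset.mem_filter.1 hp).2 hA

variable [Fintype V] [DecidableEq V] [Fintype ({w : V // w ≠ v} ⊕ {x : V // G.Adj v x})]
  [DecidableEq ({w : V // w ≠ v} ⊕ {x : V // G.Adj v x})]

theorem cutSize_compl {V : Type u} [Fintype V] [DecidableEq V] (G : SimpleGraph V)
    (S : Finset V) : cutSize G Sᶜ = cutSize G S := by
  rw [cutSize, cutSize, compl_compl, edgeCount_comm]

theorem cutSize_preimage (S : Finset V) :
    cutSize (replaceByTriangle G v) (Finset.univ.filter (collapse G v · ∈ S)) = cutSize G S := by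
  have hcompl : ∀ S : Finset V, (Finset.univ.filter (collapse G v · ∈ S))ᶜ =
      Finset.univ.filter (collapse G v · ∈ Sᶜ) := fun S => by ext; simp
  by_cases hv : v ∈ S
  · rw [← cutSize_compl, ← cutSize_compl G, cutSize, hcompl, hcompl, cutSize]
    exact edgeCount_preimage _ _ (by simpa using hv)
  · rw [cutSize, hcompl, edgeCount_preimage _ _ hv, cutSize]

theorem cutsGeThree_of_replaceByTriangle (h : CutsGeThree (replaceByTriangle G v))
    (hv : (G.neighborSet v).Nonempty) : CutsGeThree G := by
  rintro S ⟨a, ha⟩ ⟨b, hb⟩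
  rw [← cutSize_preimage (v := v)]
  obtain ⟨p, rfl⟩ := exists_collapse_eq hv a
  obtain ⟨q, rfl⟩ := exists_collapse_eq hv b
  exact h _ ⟨p, by simpa using ha⟩ ⟨q, by simpa using hb⟩

/-- A cut that does not split the triangle is a cut of `G`. One that splits it contains two triangle
edges, and a third edge is found outside the triangle. -/
theorem CutsGeThree.replaceByTriangle (hG : CutsGeThree G) (hc : IsCubic G) (v : V)
    [Fintype ({w : V // w ≠ v} ⊕ {x : V // G.Adj v x})]
    [DecidableEq ({w : V // w ≠ v} ⊕ {x : V // G.Adj v x})] :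
    CutsGeThree (replaceByTriangle G v) := by
  classical
  intro S hS hS'
  set T := CubicGraph.replaceByTriangle G v with hT
  set Q := Finset.univ.filter (fun p : {w : V // w ≠ v} ⊕ {x : V // G.Adj v x} => p.isRight) with hQ
  have hQcard : Q.card = 3 := by
    rw [← hc v, Set.ncard_eq_toFinset_card' (G.neighborSet v), Set.toFinset_card]
    have : Q = Finset.univ.image Sum.inr := by ext (p | p) <;> simp [hQ]
    rw [this, Finset.card_image_of_injective _ Sum.inr_injective, Finset.card_univ]
    exact Fintype.card_congr (Equiv.refl _)
  set I := S \ Q with hI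
  set O := Sᶜ \ Q with hO
  set A := S ∩ Q with hA
  set B := Sᶜ ∩ Q with hB
  have hAB : A.card + B.card = 3 := by
    rw [← hQcard, ← Finset.card_union_of_disjoint]
    · congr 1; ext; simp only [hA, hB, Finset.mem_union, Finset.mem_inter, Finset.mem_compl]; tauto
    · rw [Finset.disjoint_left]; intro; simp only [hA, hB, Finset.mem_inter, Finset.mem_compl]; tauto
  have hSu : S = I ∪ A := by rw [hI, hA, Finset.sdiff_union_inter]
  have hScu : Sᶜ = O ∪ B := by rw [hO, hB, Finset.sdiff_union_inter]
  have dIA : Disjoint I A := Finset.disjoint_sdiff_inter _ _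
  have dOB : Disjoint O B := Finset.disjoint_sdiff_inter _ _
  have hcutS : cutSize T S = edgeCount T I O + edgeCount T I B + (edgeCount T A O + edgeCount T A B) := by
    rw [cutSize]
    conv_lhs => rw [hScu, hSu]
    rw [edgeCount_union_left _ _ dIA, edgeCount_union_right _ _ dOB, edgeCount_union_right _ _ dOB]
  -- Each triangle vertex has exactly one neighbour outside the triangle.
  have hQin : ∀ R ⊆ Q, edgeCount T R (I ∪ O) = R.card := by
    intro R hR
    rw [edgeCount_eq_sum, Finset.card_eq_sum_ones]
    refine Finset.sum_congr rfl fun p hp => ?_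
    rcases p with p | x
    · simpa [hQ] using hR hp
    · rw [Finset.card_eq_one]
      refine ⟨Sum.inl ⟨x.1, x.2.ne'⟩, ?_⟩
      ext (a | y)
      · simp only [hT, hI, hO, hQ, Finset.mem_filter, Finset.mem_union, Finset.mem_sdiff,
          Finset.mem_compl, replaceByTriangle_adj_inr_inl, Finset.mem_singleton, Sum.inl.injEq,
          Subtype.ext_iff]
        simp; tauto
      · simp [hI, hO, hQ]
  have hABe : edgeCount T A B = A.card * B.card := by
    rw [edgeCount_eq_sum, Finset.sum_congr rfl (g := fun _ => B.card), Finset.sum_const, smul_eq_mul]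
    intro p hp
    rw [Finset.filter_true_of_mem]
    intro q hq
    rw [hA, hQ, Finset.mem_inter, Finset.mem_filter] at hp
    rw [hB, hQ, Finset.mem_inter, Finset.mem_filter] at hq
    rcases p with p | x
    · simp at hp
    rcases q with q | y
    · simp at hq
    rw [hT, replaceByTriangle_adj_inr_inr]
    rintro rfl
    exact Finset.mem_compl.1 hq.1 hp.1
  have hdisj : Disjoint I O := by
    rw [Finset.disjoint_left]; intro; simp only [hI, hO, Finset.mem_sdiff, Finset.mem_compl]; tauto
  have hAin := hQin A Finset.inter_subset_right
  have hBin := hQin B Finset.inter_subset_right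
  rw [edgeCount_union_right _ _ hdisj] at hAin hBin
  have hcutcol : ∀ R : Finset ({w : V // w ≠ v} ⊕ {x : V // G.Adj v x}), R.Nonempty →
      Disjoint R Q → 3 ≤ cutSize T R := by
    intro R hR hRQ
    have hRe : R = Finset.univ.filter (collapse G v · ∈ R.image (collapse G v)) := by
      ext p
      simp only [Finset.mem_filter, Finset.mem_univ, true_and, Finset.mem_image]
      constructor
      · exact fun hp => ⟨p, hp, rfl⟩
      · rintro ⟨q, hq, hqp⟩
        have hq' := Finset.disjoint_left.1 hRQ hq
        rcases q with q | q
        · rcases p with p | p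
          · have : q = p := Subtype.ext hqp
            rwa [← this]
          · exact absurd hqp q.2
        · simp [hQ] at hq'
    rw [hRe, hT, cutSize_preimage]
    refine hG _ (hR.image _) ⟨v, ?_⟩
    rw [Finset.mem_compl, Finset.mem_image]
    rintro ⟨q | q, hq, hqv⟩
    · exact q.2 hqv
    · exact Finset.disjoint_left.1 hRQ hq (by simp [hQ])
  have hIQ : Disjoint I Q := Finset.sdiff_disjoint
  have hOQ : Disjoint O Q := Finset.sdiff_disjoint
  rcases Nat.eq_zero_or_pos A.card with hA0 | hApos
  · have : S = I := by rw [hSu, Finset.card_eq_zero.1 hA0, Finset.union_empty]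
    rw [this]
    exact hcutcol I (this ▸ hS) hIQ
  rcases Nat.eq_zero_or_pos B.card with hB0 | hBpos
  · have : Sᶜ = O := by rw [hScu, Finset.card_eq_zero.1 hB0, Finset.union_empty]
    rw [← cutSize_compl, this]
    exact hcutcol O (this ▸ hS') hOQ
  have hAB2 : edgeCount T A B = 2 := by
    rw [hABe]
    have : A.card = 1 ∧ B.card = 2 ∨ A.card = 2 ∧ B.card = 1 := by omega
    rcases this with ⟨h1, h2⟩ | ⟨h1, h2⟩ <;> rw [h1, h2]
  rcases O.eq_empty_or_nonempty with hO0 | hOne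
  · have h0 : edgeCount T B O = 0 := by rw [hO0, edgeCount_eq_zero_iff]; simp
    rw [hO0] at hcutS h0
    rw [hcutS, edgeCount_comm T I B]
    rw [hO0] at hBin
    omega
  -- At least three edges leave `O` and at most |B| ≤ 2 of them go to `B`, so one goes to `I ∪ A`
  -- and crosses the cut.
  · have h3 := hcutcol O hOne hOQ
    have hOc : Oᶜ = I ∪ (A ∪ B) := by
      ext p
      simp only [hI, hO, hA, hB, Finset.mem_union, Finset.mem_sdiff, Finset.mem_compl,
        Finset.mem_inter]
      tauto
    have dAB : Disjoint A B := by
      rw [Finset.disjoint_left]; intro; simp only [hA, hB, Finset.mem_inter, Finset.mem_compl]; tauto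
    have d2 : Disjoint I (A ∪ B) := hIQ.mono_right
      (Finset.union_subset Finset.inter_subset_right Finset.inter_subset_right)
    rw [cutSize, hOc, edgeCount_union_right _ _ d2, edgeCount_union_right _ _ dAB,
      edgeCount_comm T O I, edgeCount_comm T O A, edgeCount_comm T O B] at h3
    rw [hcutS, edgeCount_comm T I B]
    omega

end

/-! ### Matchings of the new graph against matchings and v-joins of the old one -/

section

variable {V : Type u} {G : SimpleGraph V} {v : V}

/-- The relation on `replaceByTriangle G v` that a perfect matching of `G` induces. -/
def liftRel (G : SimpleGraph V) (v : V) (R : V → V → Prop) :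
    ({w : V // w ≠ v} ⊕ {x : V // G.Adj v x}) → ({w : V // w ≠ v} ⊕ {x : V // G.Adj v x}) → Prop
  | Sum.inl a, Sum.inl b => R a.1 b.1
  | Sum.inl a, Sum.inr x => a.1 = x.1 ∧ R v x.1
  | Sum.inr x, Sum.inl a => a.1 = x.1 ∧ R v x.1
  | Sum.inr x, Sum.inr y => x ≠ y ∧ ¬ R v x.1 ∧ ¬ R v y.1

/-- The relation on `replaceByTriangle G v` that a `v`-join of `G` induces. -/
def liftJoinRel (G : SimpleGraph V) (v : V) (R : V → V → Prop) :
    ({w : V // w ≠ v} ⊕ {x : V // G.Adj v x}) → ({w : V // w ≠ v} ⊕ {x : V // G.Adj v x}) → Prop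
  | Sum.inl a, Sum.inl b => R a.1 b.1
  | Sum.inl a, Sum.inr x => a.1 = x.1
  | Sum.inr x, Sum.inl a => a.1 = x.1
  | Sum.inr _, Sum.inr _ => False

/-- The relation on `G` that a relation on `replaceByTriangle G v` induces. -/
def collapseRel (G : SimpleGraph V) (v : V)
    (R : ({w : V // w ≠ v} ⊕ {x : V // G.Adj v x}) →
      ({w : V // w ≠ v} ⊕ {x : V // G.Adj v x}) → Prop) (a b : V) : Prop :=
  ∃ p q, collapse G v p = a ∧ collapse G v q = b ∧ a ≠ b ∧ R p q

theorem IsCubic.exists_third (h : IsCubic G) {y z : V} (hy : G.Adj v y) (hz : G.Adj v z)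
    (hyz : y ≠ z) : ∃ x, G.Adj v x ∧ x ≠ y ∧ x ≠ z ∧ ∀ w, G.Adj v w → w = x ∨ w = y ∨ w = z := by
  have h1 : ((G.neighborSet v \ {y}) \ {z}).ncard = 1 := by
    rw [Set.ncard_sdiff_singleton_of_mem
        (show z ∈ G.neighborSet v \ {y} from ⟨hz, hyz.symm⟩),
      Set.ncard_sdiff_singleton_of_mem (show y ∈ G.neighborSet v from hy), h v]
  obtain ⟨x, hx⟩ := Set.ncard_eq_one.1 h1
  have hm : ∀ w, (G.Adj v w ∧ w ≠ y) ∧ w ≠ z ↔ w = x := fun w => by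
    simpa using Set.ext_iff.1 hx w
  have h2 := (hm x).2 rfl
  exact ⟨x, h2.1.1, h2.1.2, h2.2, fun w hw => by have := hm w; tauto⟩

theorem IsCubic.exists_two (h : IsCubic G) {x : V} (hx : G.Adj v x) :
    ∃ y z, G.Adj v y ∧ G.Adj v z ∧ y ≠ z ∧ x ≠ y ∧ x ≠ z ∧
      ∀ w, G.Adj v w → w = x ∨ w = y ∨ w = z := by
  have h1 : (G.neighborSet v \ {x}).ncard = 2 := by
    rw [Set.ncard_sdiff_singleton_of_mem (show x ∈ G.neighborSet v from hx), h v]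
  obtain ⟨y, z, hyz, hx'⟩ := Set.ncard_eq_two.1 h1
  have hm : ∀ w, G.Adj v w ∧ w ≠ x ↔ w = y ∨ w = z := fun w => by
    simpa using Set.ext_iff.1 hx' w
  have hy := (hm y).2 (Or.inl rfl)
  have hz := (hm z).2 (Or.inr rfl)
  exact ⟨y, z, hy.1, hz.1, hyz, hy.2.symm, hz.2.symm, fun w hw => by have := hm w; tauto⟩

/-- The partner of `v` determines which new vertex is matched outwards; the other two are matched to
each other, and there are exactly two because `G` is cubic. -/
theorem IsPM.liftRel (hc : IsCubic G) {R : V → V → Prop} (h : IsPM G R) :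
    IsPM (replaceByTriangle G v) (liftRel G v R) := by
  refine ⟨?_, ?_, ?_⟩
  · rintro (a | x) (b | y) hab
    · exact h.1 _ _ hab
    · exact hab
    · exact hab
    · exact ⟨hab.1.symm, hab.2.2, hab.2.1⟩
  · rintro (a | x) (b | y) hab
    · exact h.2.1 _ _ hab
    · exact hab.1
    · exact hab.1
    · exact hab.1
  · rintro (a | x)
    · obtain ⟨b, hb, hu⟩ := h.2.2 a.1
      by_cases hbv : b = v
      · subst hbv
        have hav := h.1 _ _ hb
        refine ⟨Sum.inr ⟨a.1, h.2.1 _ _ hav⟩, ⟨rfl, hav⟩, ?_⟩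
        rintro (c | y) hcy
        · exact absurd (hu _ hcy) c.2
        · exact congrArg Sum.inr (Subtype.ext hcy.1.symm)
      · refine ⟨Sum.inl ⟨b, hbv⟩, hb, ?_⟩
        rintro (c | y) hcy
        · exact congrArg Sum.inl (Subtype.ext (hu _ hcy))
        · obtain ⟨h1, h2⟩ := hcy
          rw [← h1] at h2
          exact absurd (hu _ (h.1 _ _ h2)).symm hbv
    · by_cases hx : R v x.1
      · refine ⟨Sum.inl ⟨x.1, x.2.ne'⟩, ⟨rfl, hx⟩, ?_⟩
        rintro (c | y) hcy
        · exact congrArg Sum.inl (Subtype.ext hcy.1)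
        · exact absurd hx hcy.2.1
      · obtain ⟨z, hz, hu⟩ := h.2.2 v
        have hxz : x.1 ≠ z := fun e => hx (e ▸ hz)
        obtain ⟨y, hy, hyx, hyz, hall⟩ := hc.exists_third x.2 (h.2.1 _ _ hz) hxz
        refine ⟨Sum.inr ⟨y, hy⟩, ⟨fun e => hyx (congrArg Subtype.val e).symm, hx,
          fun e => hyz (hu _ e)⟩, ?_⟩
        rintro (c | w) hcw
        · exact absurd hcw.2 hx
        · obtain ⟨h1, -, h3⟩ := hcw
          refine congrArg Sum.inr (Subtype.ext ?_)
          rcases hall w.1 w.2 with e | e | e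
          · exact e
          · exact absurd (Subtype.ext e.symm) h1
          · exact absurd (e ▸ hz) h3

theorem isPM_liftJoinRel (hc : IsCubic G) {J : G.Subgraph} (h : IsJoin v J) :
    IsPM (replaceByTriangle G v) (liftJoinRel G v J.Adj) := by
  obtain ⟨-, h3, h1⟩ := h
  -- Degree 3 at `v` in both graphs means that the join uses every edge at `v`.
  have hv : ∀ x, G.Adj v x → J.Adj v x := by
    have hsub : J.neighborSet v ⊆ G.neighborSet v := fun x hx => J.adj_sub hx
    have := Set.eq_of_subset_of_ncard_le hsub (by rw [h3, hc v])
      (Set.finite_of_ncard_ne_zero (by rw [hc v]; simp))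
    intro x hx
    have hx' : x ∈ G.neighborSet v := hx
    rwa [← this] at hx'
  refine ⟨?_, ?_, ?_⟩
  · rintro (a | x) (b | y) hab
    · exact SimpleGraph.Subgraph.Adj.symm hab
    · exact hab
    · exact hab
    · exact hab
  · rintro (a | x) (b | y) hab
    · exact J.adj_sub hab
    · exact hab
    · exact hab
    · exact hab.elim
  · rintro (a | x)
    · obtain ⟨b, hb⟩ := Set.ncard_eq_one.1 (h1 a.1 a.2)
      have hb' : ∀ w, J.Adj a.1 w ↔ w = b := fun w => by
        rw [← SimpleGraph.Subgraph.mem_neighborSet, hb, Set.mem_singleton_iff]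
      by_cases hbv : b = v
      · subst hbv
        refine ⟨Sum.inr ⟨a.1, (J.adj_sub ((hb' _).2 rfl)).symm⟩, rfl, ?_⟩
        rintro (c | y) hcy
        · exact absurd ((hb' _).1 hcy) c.2
        · exact congrArg Sum.inr (Subtype.ext hcy.symm)
      · refine ⟨Sum.inl ⟨b, hbv⟩, (hb' _).2 rfl, ?_⟩
        rintro (c | y) hcy
        · exact congrArg Sum.inl (Subtype.ext ((hb' _).1 hcy))
        · have h1 : a.1 = y.1 := hcy
          have h2 := hv y.1 y.2
          rw [← h1] at h2
          exact absurd ((hb' _).1 h2.symm).symm hbv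
    · refine ⟨Sum.inl ⟨x.1, x.2.ne'⟩, rfl, ?_⟩
      rintro (c | y) hcy
      · exact congrArg Sum.inl (Subtype.ext hcy)
      · exact hcy.elim

variable {R : ({w : V // w ≠ v} ⊕ {x : V // G.Adj v x}) →
      ({w : V // w ≠ v} ⊕ {x : V // G.Adj v x}) → Prop}

theorem collapseRel_symm (h : IsPM (replaceByTriangle G v) R) {a b : V}
    (hab : collapseRel G v R a b) : collapseRel G v R b a := by
  obtain ⟨p, q, hp, hq, hne, hR⟩ := hab
  exact ⟨q, p, hq, hp, hne.symm, h.1 _ _ hR⟩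

theorem collapseRel_vertex_iff (h : IsPM (replaceByTriangle G v) R) {x : V} :
    collapseRel G v R v x ↔
      ∃ hx : G.Adj v x, R (Sum.inr ⟨x, hx⟩) (Sum.inl ⟨x, hx.ne'⟩) := by
  constructor
  · rintro ⟨p | p, q | q, hp, hq, hne, hR⟩
    · exact absurd hp p.2
    · exact absurd hp p.2
    · have h1 : q.1 = p.1 := h.2.1 _ _ hR
      obtain ⟨p, hp'⟩ := p
      obtain ⟨q, hq'⟩ := q
      simp only [collapse_inl] at hq h1
      subst hq
      subst h1
      exact ⟨hp', hR⟩
    · exact absurd hq hne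
  · rintro ⟨hx, hR⟩
    exact ⟨_, _, rfl, rfl, hx.ne, hR⟩

theorem collapseRel_adj (h : IsPM (replaceByTriangle G v) R) {a b : V}
    (hab : collapseRel G v R a b) : G.Adj a b := by
  by_cases ha : a = v
  · subst ha
    exact ((collapseRel_vertex_iff h).1 hab).1
  by_cases hb : b = v
  · subst hb
    exact ((collapseRel_vertex_iff h).1 (collapseRel_symm h hab)).1.symm
  obtain ⟨p | p, q | q, hp, hq, hne, hR⟩ := hab
  · have := h.2.1 _ _ hR
    rw [← hp, ← hq]; exact this
  · exact absurd hq.symm hb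
  · exact absurd hp.symm ha
  · exact absurd hp.symm ha

theorem collapseRel_inl_iff {a b : {w : V // w ≠ v}} (h : IsPM (replaceByTriangle G v) R) :
    collapseRel G v R a.1 b.1 ↔ R (Sum.inl a) (Sum.inl b) := by
  constructor
  · rintro ⟨p | p, q | q, hp, hq, hne, hR⟩
    · rwa [← Subtype.ext hp, ← Subtype.ext hq]
    · exact absurd hq.symm b.2
    · exact absurd hp.symm a.2
    · exact absurd hp.symm a.2
  · intro hR
    exact ⟨_, _, rfl, rfl, (show G.Adj a.1 b.1 from h.2.1 _ _ hR).ne, hR⟩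

/-- No assumption on triangle edges is needed away from `v`, so this serves both for perfect
matchings and for v-joins. -/
theorem existsUnique_collapseRel (h : IsPM (replaceByTriangle G v) R) {a : V} (ha : a ≠ v) :
    ∃! b, collapseRel G v R a b := by
  obtain ⟨q, hq, hu⟩ := h.2.2 (Sum.inl ⟨a, ha⟩)
  refine ⟨collapse G v q, ⟨_, q, rfl, rfl, ?_, hq⟩, ?_⟩
  · have := h.2.1 _ _ hq
    rcases q with q | q
    · exact SimpleGraph.Adj.ne this
    · exact ha
  · rintro b ⟨p | p, r, hp, rfl, hne, hR⟩
    · rw [show p = ⟨a, ha⟩ from Subtype.ext hp] at hR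
      rw [hu _ hR]
    · exact absurd hp.symm ha

/-- In a perfect matching with an edge in the triangle, exactly the third vertex of the triangle
is matched outside. -/
theorem collapseRel_vertex_iff_of_inr (hc : IsCubic G) (h : IsPM (replaceByTriangle G v) R)
    {y z : {x : V // G.Adj v x}} (hyz : R (Sum.inr y) (Sum.inr z)) (w : {x : V // G.Adj v x}) :
    collapseRel G v R v w.1 ↔ w ≠ y ∧ w ≠ z := by
  rw [collapseRel_vertex_iff h]
  constructor
  · rintro ⟨hadj, hw⟩
    constructor
    · rintro rfl
      exact Sum.inl_ne_inr (h.eq hw hyz)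
    · rintro rfl
      exact Sum.inl_ne_inr (h.eq hw (h.1 _ _ hyz))
  · rintro ⟨hwy, hwz⟩
    refine ⟨w.2, ?_⟩
    have hne : y ≠ z := h.2.1 _ _ hyz
    obtain ⟨x, hx, hxy, hxz, hall⟩ := hc.exists_third y.2 z.2 (fun e => hne (Subtype.ext e))
    obtain ⟨q, hq, -⟩ := h.2.2 (Sum.inr w)
    have hadj := h.2.1 _ _ hq
    rcases q with q | q
    · have : q = ⟨w.1, w.2.ne'⟩ := Subtype.ext hadj
      rwa [← this]
    · exfalso
      have hwq : w ≠ q := hadj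
      have : q = y ∨ q = z := by
        rw [Subtype.ext_iff, Subtype.ext_iff]
        rw [Ne, Subtype.ext_iff] at hwy hwz hwq
        have h1 := hall w.1 w.2
        have h2 := hall q.1 q.2
        grind
      rcases this with rfl | rfl
      · exact hwz (Sum.inr_injective (h.eq (h.1 _ _ hq) hyz))
      · exact hwy (Sum.inr_injective (h.eq (h.1 _ _ hq) (h.1 _ _ hyz)))

theorem IsPM.collapseRel (hc : IsCubic G) (h : IsPM (replaceByTriangle G v) R)
    {y z : {x : V // G.Adj v x}} (hyz : R (Sum.inr y) (Sum.inr z)) :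
    IsPM G (collapseRel G v R) := by
  refine ⟨fun a b => collapseRel_symm h, fun a b => collapseRel_adj h, fun a => ?_⟩
  by_cases ha : a = v
  · subst ha
    have hne : y ≠ z := h.2.1 _ _ hyz
    obtain ⟨x, hx, hxy, hxz, hall⟩ := hc.exists_third y.2 z.2 (fun e => hne (Subtype.ext e))
    refine ⟨x, (collapseRel_vertex_iff_of_inr hc h hyz ⟨x, hx⟩).2
      ⟨fun e => hxy (congrArg Subtype.val e), fun e => hxz (congrArg Subtype.val e)⟩, ?_⟩
    intro w hw
    have hw' := collapseRel_adj h hw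
    obtain ⟨h1, h2⟩ := (collapseRel_vertex_iff_of_inr hc h hyz ⟨w, hw'⟩).1 hw
    rw [Ne, Subtype.ext_iff] at h1 h2
    have := hall w hw'
    tauto
  · exact existsUnique_collapseRel h ha

theorem liftRel_collapseRel (hc : IsCubic G) (h : IsPM (replaceByTriangle G v) R)
    {y z : {x : V // G.Adj v x}} (hyz : R (Sum.inr y) (Sum.inr z)) :
    liftRel G v (collapseRel G v R) = R := by
  have hl : IsPM (replaceByTriangle G v) (liftRel G v (CubicGraph.collapseRel G v R)) :=
    (h.collapseRel hc hyz).liftRel hc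
  -- Both relations are perfect matchings, so one inclusion gives equality.
  have hle : ∀ p q, R p q → liftRel G v (CubicGraph.collapseRel G v R) p q := by
    have hv := collapseRel_vertex_iff_of_inr hc h hyz
    rintro (a | a) (b | b) hR
    · exact (collapseRel_inl_iff h).2 hR
    · have hab : a.1 = b.1 := h.2.1 _ _ hR
      have : a = ⟨b.1, b.2.ne'⟩ := Subtype.ext hab
      exact ⟨hab, (collapseRel_vertex_iff h).2 ⟨b.2, h.1 _ _ (this ▸ hR)⟩⟩
    · have hab : b.1 = a.1 := h.2.1 _ _ hR
      have : b = ⟨a.1, a.2.ne'⟩ := Subtype.ext hab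
      exact ⟨hab, (collapseRel_vertex_iff h).2 ⟨a.2, this ▸ hR⟩⟩
    · refine ⟨h.2.1 _ _ hR, fun ha => ?_, fun hb => ?_⟩
      · obtain ⟨h1, h2⟩ := (collapseRel_vertex_iff h).1 ha
        exact Sum.inl_ne_inr (h.eq h2 hR)
      · obtain ⟨h1, h2⟩ := (collapseRel_vertex_iff h).1 hb
        exact Sum.inl_ne_inr (h.eq h2 (h.1 _ _ hR))
  ext p q
  refine ⟨fun hl' => ?_, hle p q⟩
  obtain ⟨r, hr, -⟩ := h.2.2 p
  rwa [hl.eq hl' (hle _ _ hr)]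

theorem collapseRel_liftRel (hc : IsCubic G) {N : V → V → Prop} (hN : IsPM G N) :
    collapseRel G v (liftRel G v N) = N := by
  have hl : IsPM (replaceByTriangle G v) (liftRel G v N) := hN.liftRel hc
  have hv : ∀ x, collapseRel G v (liftRel G v N) v x ↔ N v x := fun x => by
    rw [collapseRel_vertex_iff hl]
    exact ⟨fun ⟨hx, h1, h2⟩ => h2, fun hx => ⟨hN.2.1 _ _ hx, rfl, hx⟩⟩
  ext a b
  by_cases ha : a = v
  · rw [ha]; exact hv b
  by_cases hb : b = v
  · rw [hb]
    exact ⟨fun h => hN.1 _ _ ((hv a).1 (collapseRel_symm hl h)),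
      fun h => collapseRel_symm hl ((hv a).2 (hN.1 _ _ h))⟩
  · exact collapseRel_inl_iff (a := ⟨a, ha⟩) (b := ⟨b, hb⟩) hl

theorem exists_isJoin_of_isPM (hc : IsCubic G) (h : IsPM (replaceByTriangle G v) R)
    (hno : ∀ y z, ¬ R (Sum.inr y) (Sum.inr z)) :
    ∃ J : G.Subgraph, IsJoin v J ∧ J.Adj = collapseRel G v R := by
  refine ⟨subgraphOfRel G (collapseRel G v R) (fun a b => collapseRel_symm h)
    (fun a b => collapseRel_adj h), ⟨fun _ => Set.mem_univ _, ?_, ?_⟩, rfl⟩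
  · rw [← hc v]
    congr 1
    ext x
    change collapseRel G v R v x ↔ G.Adj v x
    refine ⟨collapseRel_adj h, fun hx => (collapseRel_vertex_iff h).2 ⟨hx, ?_⟩⟩
    obtain ⟨q, hq, -⟩ := h.2.2 (Sum.inr ⟨x, hx⟩)
    rcases q with q | q
    · have : q = ⟨x, hx.ne'⟩ := Subtype.ext (h.2.1 _ _ hq)
      rwa [← this]
    · exact absurd hq (hno _ _)
  · intro w hw
    obtain ⟨b, hb, hu⟩ := existsUnique_collapseRel h hw
    rw [Set.ncard_eq_one]
    refine ⟨b, Set.ext fun c => ?_⟩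
    rw [Set.mem_singleton_iff]
    exact ⟨hu c, fun e => e ▸ hb⟩

end

/-! ### Transfer of lonely edges -/

/-- If `e` joins `v` to x, the triangle edge opposite the new vertex of x is lonely: a matching
through it collapses to one through `e`. If `e` avoids `v`, it stays lonely, as a matching through
it without a triangle edge would collapse to a v-join containing `e`. -/
theorem IsLonely.exists_replaceByTriangle {V : Type u} {G : SimpleGraph V} {v : V}
    (hc : IsCubic G) {e : Sym2 V} (he : IsLonely G e)
    (hv : v ∈ e ∨ ¬ ∃ J : G.Subgraph, IsJoin v J ∧ e ∈ J.edgeSet) :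
    ∃ e', IsLonely (replaceByTriangle G v) e' := by
  by_cases hve : v ∈ e
  · obtain ⟨x, rfl⟩ := hve
    rw [isLonely_iff] at he
    obtain ⟨R, ⟨hR, hvx⟩, hu⟩ := he
    obtain ⟨y, z, hy, hz, hyz, hxy, hxz, hall⟩ := hc.exists_two (hR.2.1 _ _ hvx)
    refine ⟨s(Sum.inr ⟨y, hy⟩, Sum.inr ⟨z, hz⟩), isLonely_iff.2 ⟨liftRel G v R,
      ⟨hR.liftRel hc, fun h => hyz (congrArg Subtype.val h), fun h => hxy (hR.eq hvx h),
        fun h => hxz (hR.eq hvx h)⟩, ?_⟩⟩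
    rintro M ⟨hM, hMyz⟩
    have h1 := (collapseRel_vertex_iff_of_inr hc hM hMyz ⟨x, hR.2.1 _ _ hvx⟩).2
      ⟨fun h => hxy (congrArg Subtype.val h), fun h => hxz (congrArg Subtype.val h)⟩
    rw [← hu _ ⟨hM.collapseRel hc hMyz, h1⟩, liftRel_collapseRel hc hM hMyz]
  · have hno := hv.resolve_left hve
    induction e with | _ a b
    rw [Sym2.mem_iff, not_or] at hve
    rw [isLonely_iff] at he
    obtain ⟨R, ⟨hR, hab⟩, hu⟩ := he
    refine ⟨s(Sum.inl ⟨a, Ne.symm hve.1⟩, Sum.inl ⟨b, Ne.symm hve.2⟩), isLonely_iff.2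
      ⟨liftRel G v R, ⟨hR.liftRel hc, hab⟩, ?_⟩⟩
    rintro M ⟨hM, hMab⟩
    have hMab' : collapseRel G v M a b := (collapseRel_inl_iff hM).2 hMab
    by_cases hin : ∃ y z, M (Sum.inr y) (Sum.inr z)
    · obtain ⟨y, z, hyz⟩ := hin
      rw [← hu _ ⟨hM.collapseRel hc hyz, hMab'⟩, liftRel_collapseRel hc hM hyz]
    · push Not at hin
      obtain ⟨J, hJ, hJa⟩ := exists_isJoin_of_isPM hc hM hin
      refine absurd ⟨J, hJ, ?_⟩ hno
      rw [SimpleGraph.Subgraph.mem_edgeSet, hJa]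
      exact hMab'

/-- If the lonely edge meets the triangle, the edge at `v` of the collapsed matching is lonely,
because every matching of `G` through that edge lifts to one through `s(p, q)`. Otherwise the edge
itself stays lonely. -/
theorem IsLonely.exists_of_replaceByTriangle {V : Type u} {G : SimpleGraph V} {v : V}
    (hc : IsCubic G) {p q : {w : V // w ≠ v} ⊕ {x : V // G.Adj v x}}
    (he : IsLonely (replaceByTriangle G v) s(p, q))
    {R : ({w : V // w ≠ v} ⊕ {x : V // G.Adj v x}) →
      ({w : V // w ≠ v} ⊕ {x : V // G.Adj v x}) → Prop}
    (hR : IsPM (replaceByTriangle G v) R) (hpq : R p q)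
    {y z : {x : V // G.Adj v x}} (hyz : R (Sum.inr y) (Sum.inr z)) :
    ∃ e, IsLonely G e ∧ (v ∈ e ∨ ¬ ∃ J : G.Subgraph, IsJoin v J ∧ e ∈ J.edgeSet) := by
  rw [isLonely_iff] at he
  have hu : ∀ M, IsPM (replaceByTriangle G v) M → M p q → M = R := fun M hM hMpq =>
    he.unique ⟨hM, hMpq⟩ ⟨hR, hpq⟩
  have hC := hR.collapseRel hc hyz
  have hvx := collapseRel_vertex_iff_of_inr hc hR hyz
  -- a lonely edge at the collapsed vertex
  have hinc : (∀ x, collapseRel G v R v x → ∀ N : V → V → Prop, IsPM G N → N v x →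
      liftRel G v N p q) → ∃ e, IsLonely G e ∧
        (v ∈ e ∨ ¬ ∃ J : G.Subgraph, IsJoin v J ∧ e ∈ J.edgeSet) := by
    intro h
    obtain ⟨x, hx, -⟩ := hC.2.2 v
    refine ⟨s(v, x), isLonely_iff.2 ⟨_, ⟨hC, hx⟩, ?_⟩, Or.inl (by simp)⟩
    rintro N ⟨hN, hNx⟩
    rw [← hu _ (hN.liftRel hc) (h x hx N hN hNx), collapseRel_liftRel hc hN]
  rcases p with a | a <;> rcases q with b | b
  · refine ⟨s(a.1, b.1), isLonely_iff.2 ⟨_, ⟨hC, (collapseRel_inl_iff hR).2 hpq⟩, ?_⟩, Or.inr ?_⟩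
    · rintro N ⟨hN, hNab⟩
      rw [← hu _ (hN.liftRel hc) hNab, collapseRel_liftRel hc hN]
    -- Such a join lifts to a matching through the lonely edge with no triangle edge, hence
    -- different from `R`.
    · rintro ⟨J, hJ, hab⟩
      have := hu _ (isPM_liftJoinRel hc hJ) hab
      rw [← this] at hyz
      exact hyz
  · refine hinc fun x hx N hN hNx => ?_
    have h1 : a.1 = b.1 := hR.2.1 _ _ hpq
    have h2 : collapseRel G v R v b.1 := by
      rw [hvx]
      exact ⟨fun e => Sum.inl_ne_inr (hR.eq (hR.1 _ _ hpq) (e ▸ hyz)),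
        fun e => Sum.inl_ne_inr (hR.eq (hR.1 _ _ hpq) (e ▸ hR.1 _ _ hyz))⟩
    exact ⟨h1, hC.eq hx h2 ▸ hNx⟩
  · refine hinc fun x hx N hN hNx => ?_
    have h1 : b.1 = a.1 := hR.2.1 _ _ hpq
    have h2 : collapseRel G v R v a.1 := by
      rw [hvx]
      exact ⟨fun e => Sum.inl_ne_inr (hR.eq hpq (e ▸ hyz)),
        fun e => Sum.inl_ne_inr (hR.eq hpq (e ▸ hR.1 _ _ hyz))⟩
    exact ⟨h1, hC.eq hx h2 ▸ hNx⟩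
  · refine hinc fun x hx N hN hNx => ?_
    have hvx' := collapseRel_vertex_iff_of_inr hc hR hpq ⟨x, hC.2.1 _ _ hx⟩
    obtain ⟨h1, h2⟩ := hvx'.1 hx
    exact ⟨hR.2.1 _ _ hpq, fun h => h1 (Subtype.ext (hN.eq hNx h)),
      fun h => h2 (Subtype.ext (hN.eq hNx h))⟩

/-! ### Contracting a triangle -/

/-- The graph obtained from `G` by contracting `T` to a single vertex `none`. -/
def contract {V : Type u} (G : SimpleGraph V) (T : Set V) :
    SimpleGraph (Option {w : V // w ∉ T}) where
  Adj
    | some a, some b => G.Adj a.1 b.1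
    | none, some b => ∃ t ∈ T, G.Adj t b.1
    | some a, none => ∃ t ∈ T, G.Adj t a.1
    | none, none => False
  symm := ⟨by
    rintro (_ | a) (_ | b) h
    · exact h
    · exact h
    · exact h
    · exact SimpleGraph.Adj.symm h⟩
  loopless := ⟨by
    rintro (_ | a) h
    · exact h
    · exact G.loopless.irrefl _ h⟩

/-- Since outer neighbours are distinct, `o t` can serve as the label of the new vertex that
corresponds to `t`. -/
theorem exists_iso_replaceByTriangle_contract {V : Type u} (G : SimpleGraph V) (T : Set V)
    (hT : ∀ s ∈ T, ∀ t ∈ T, s ≠ t → G.Adj s t) (o : V → V) (ho : ∀ t ∈ T, o t ∉ T)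
    (hadj : ∀ t ∈ T, ∀ w, w ∉ T → (G.Adj t w ↔ w = o t))
    (hinj : ∀ s ∈ T, ∀ t ∈ T, o s = o t → s = t) :
    ∃ φ : G ≃g replaceByTriangle (contract G T) none, ∀ t ∈ T, ∃ y, φ t = Sum.inr y := by
  classical
  let g : ∀ u, u ∈ T → {x : Option {w : V // w ∉ T} // (contract G T).Adj none x} :=
    fun u hu => ⟨some ⟨o u, ho u hu⟩, u, hu, (hadj u hu _ (ho u hu)).2 rfl⟩
  have hg : ∀ u hu w hw, g u hu = g w hw ↔ o u = o w := fun u hu w hw =>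
    ⟨fun h => congrArg Subtype.val (Option.some.inj (congrArg Subtype.val h)),
      fun h => Subtype.ext (congrArg some (Subtype.ext h))⟩
  have hg' : ∀ u (hu : u ∉ T) w hw, some ⟨u, hu⟩ = (g w hw).1 ↔ u = o w := fun u hu w hw =>
    ⟨fun h => congrArg Subtype.val (Option.some.inj h), fun h => congrArg some (Subtype.ext h)⟩
  let k : ∀ u, u ∉ T → {w : Option {w : V // w ∉ T} // w ≠ none} :=
    fun u hu => ⟨some ⟨u, hu⟩, Option.some_ne_none _⟩
  let f : V → {w : Option {w : V // w ∉ T} // w ≠ none} ⊕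
      {x : Option {w : V // w ∉ T} // (contract G T).Adj none x} := fun u =>
    if hu : u ∈ T then Sum.inr (g u hu) else Sum.inl (k u hu)
  have f1 : ∀ u (hu : u ∈ T), f u = Sum.inr (g u hu) := fun u hu => dif_pos hu
  have f2 : ∀ u (hu : u ∉ T), f u = Sum.inl (k u hu) := fun u hu => dif_neg hu
  have hbij : Function.Bijective f := by
    constructor
    · intro u w h
      by_cases hu : u ∈ T <;> by_cases hw : w ∈ T
      · rw [f1 u hu, f1 w hw] at h
        exact hinj u hu w hw ((hg u hu w hw).1 (Sum.inr_injective h))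
      · rw [f1 u hu, f2 w hw] at h
        exact absurd h.symm Sum.inl_ne_inr
      · rw [f2 u hu, f1 w hw] at h
        exact absurd h Sum.inl_ne_inr
      · rw [f2 u hu, f2 w hw] at h
        exact congrArg Subtype.val (Option.some.inj (congrArg Subtype.val (Sum.inl_injective h)))
    · rintro (⟨_ | w, hw⟩ | ⟨_ | w, hw⟩)
      · exact absurd rfl hw
      · exact ⟨w.1, f2 w.1 w.2⟩
      · exact hw.elim
      · obtain ⟨t, ht, htw⟩ := hw
        refine ⟨t, (f1 t ht).trans (congrArg Sum.inr (Subtype.ext (congrArg some ?_)))⟩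
        exact Subtype.ext ((hadj t ht _ w.2).1 htw).symm
  refine ⟨⟨Equiv.ofBijective f hbij, ?_⟩, fun t ht => ⟨_, f1 t ht⟩⟩
  intro u w
  simp only [Equiv.ofBijective_apply]
  by_cases hu : u ∈ T <;> by_cases hw : w ∈ T
  · rw [f1 u hu, f1 w hw, replaceByTriangle_adj_inr_inr, Ne, hg u hu w hw]
    exact ⟨fun h => hT u hu w hw fun e => h (by rw [e]), fun h e => h.ne (hinj u hu w hw e)⟩
  · rw [f1 u hu, f2 w hw, replaceByTriangle_adj_inr_inl, hadj u hu w hw]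
    exact hg' w hw u hu
  · rw [f2 u hu, f1 w hw, replaceByTriangle_adj_inl_inr, G.adj_comm, hadj w hw u hu]
    exact hg' u hu w hw
  · rw [f2 u hu, f2 w hw]
    exact Iff.rfl

/-- Four vertices spanning five edges would have at most 12 - 10 = 2 leaving edges. The bound on |V|
keeps the complement nonempty and thus excludes the complete graph on four vertices. -/
theorem not_adj_two_of_triangle {V : Type u} [Fintype V] [DecidableEq V] {G : SimpleGraph V}
    (hc : IsCubic G) (hG : CutsGeThree G) (hV : 4 < Fintype.card V) {a b c w : V}
    (hab : G.Adj a b) (hac : G.Adj a c) (hbc : G.Adj b c) (hwc : w ≠ c)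
    (hwa : G.Adj w a) (hwb : G.Adj w b) : False := by
  classical
  set Q : Finset V := {a, b, c, w} with hQ
  have hcard : Q.card = 4 := by
    rw [hQ, Finset.card_insert_of_notMem, Finset.card_insert_of_notMem, Finset.card_pair hwc.symm]
    · simp [hbc.ne, hwb.ne']
    · simp [hab.ne, hac.ne, hwa.ne']
  have h1 := hc.edgeCount_add_cutSize Q
  have h2 := hG Q ⟨a, by simp [hQ]⟩ (by
    rw [← Finset.card_pos, Finset.card_compl]; omega)
  have h3 : 10 ≤ edgeCount G Q Q := by
    have e1 : ∀ f : V → ℕ, ∑ x ∈ Q, f x = f a + (f b + (f c + f w)) := by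
      intro f
      rw [hQ, Finset.sum_insert, Finset.sum_insert, Finset.sum_pair hwc.symm]
      · simp [hbc.ne, hwb.ne']
      · simp [hab.ne, hac.ne, hwa.ne']
    rw [edgeCount, e1, e1, e1, e1, e1]
    simp only [hab, hac, hbc, hwa, hwb, hab.symm, hac.symm, hbc.symm, hwa.symm, hwb.symm, if_true]
    omega
  omega

theorem exists_iso_of_triangle {V : Type u} [Fintype V] [DecidableEq V] {G : SimpleGraph V}
    (hc : IsCubic G) (hG : CutsGeThree G) (hV : 4 < Fintype.card V) {a b c : V}
    (hab : G.Adj a b) (hac : G.Adj a c) (hbc : G.Adj b c) :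
    ∃ φ : G ≃g replaceByTriangle (contract G {a, b, c}) none,
      ∀ t ∈ ({a, b, c} : Set V), ∃ y, φ t = Sum.inr y := by
  have key : ∀ t ∈ ({a, b, c} : Set V), ∃ w, w ∉ ({a, b, c} : Set V) ∧
      ∀ u, u ∉ ({a, b, c} : Set V) → (G.Adj t u ↔ u = w) := by
    have aux : ∀ a b c, G.Adj a b → G.Adj a c → G.Adj b c → ∃ w, (w ≠ a ∧ w ≠ b ∧ w ≠ c) ∧
        ∀ u, u ≠ a → u ≠ b → u ≠ c → (G.Adj a u ↔ u = w) := by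
      intro a b c hab hac hbc
      obtain ⟨x, hx, hxb, hxc, hall⟩ := hc.exists_third hab hac hbc.ne
      refine ⟨x, ⟨hx.ne', hxb, hxc⟩, fun u _ hub huc => ⟨fun h => ?_, fun h => h ▸ hx⟩⟩
      have := hall u h
      tauto
    simp only [Set.mem_insert_iff, Set.mem_singleton_iff, not_or]
    rintro t (rfl | rfl | rfl)
    · obtain ⟨w, hw, h⟩ := aux _ _ _ hab hac hbc
      exact ⟨w, hw, fun u hu => h u hu.1 hu.2.1 hu.2.2⟩
    · obtain ⟨w, hw, h⟩ := aux _ _ _ hab.symm hbc hac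
      exact ⟨w, ⟨hw.2.1, hw.1, hw.2.2⟩, fun u hu => h u hu.2.1 hu.1 hu.2.2⟩
    · obtain ⟨w, hw, h⟩ := aux _ _ _ hac.symm hbc.symm hab
      exact ⟨w, ⟨hw.2.1, hw.2.2, hw.1⟩, fun u hu => h u hu.2.2 hu.1 hu.2.1⟩
  have : Nonempty V := ⟨a⟩
  choose! o ho hadj using key
  refine exists_iso_replaceByTriangle_contract G {a, b, c} ?_ o ho hadj ?_
  · simp only [Set.mem_insert_iff, Set.mem_singleton_iff]
    rintro s (rfl | rfl | rfl) t (rfl | rfl | rfl) hne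
    all_goals first
      | exact absurd rfl hne
      | assumption
      | exact SimpleGraph.Adj.symm (by assumption)
  · intro s hs t ht hst
    by_contra hne
    have h1 : G.Adj (o s) s := ((hadj s hs _ (ho s hs)).2 rfl).symm
    have h2 : G.Adj (o s) t := ((hadj t ht _ (ho s hs)).2 hst).symm
    have h3 := ho s hs
    simp only [Set.mem_insert_iff, Set.mem_singleton_iff, not_or] at hs ht h3
    rcases hs with rfl | rfl | rfl <;> rcases ht with rfl | rfl | rfl
    · exact hne rfl
    · exact not_adj_two_of_triangle hc hG hV hab hac hbc h3.2.2 h1 h2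
    · exact not_adj_two_of_triangle hc hG hV hac hab hbc.symm h3.2.1 h1 h2
    · exact not_adj_two_of_triangle hc hG hV hab hac hbc h3.2.2 h2 h1
    · exact hne rfl
    · exact not_adj_two_of_triangle hc hG hV hbc hab.symm hac.symm h3.1 h1 h2
    · exact not_adj_two_of_triangle hc hG hV hac hab hbc.symm h3.2.1 h2 h1
    · exact not_adj_two_of_triangle hc hG hV hbc hab.symm hac.symm h3.1 h2 h1
    · exact hne rfl

/-! ### The two inclusions -/

theorem InU.replaceByTriangle {V : Type u} {G : SimpleGraph V} (h : InU G) {e : Sym2 V} {v : V}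
    (he : IsLonely G e) (hv : v ∈ e ∨ ¬ ∃ J : G.Subgraph, IsJoin v J ∧ e ∈ J.edgeSet) :
    InU (replaceByTriangle G v) := by
  classical
  obtain ⟨hc, h3, -⟩ := h
  have hfin : Finite V := h3.1
  have := Fintype.ofFinite V
  have hG := h3.cutsGeThree hc
  obtain ⟨x, hx⟩ := Set.nonempty_of_ncard_ne_zero (s := G.neighborSet v) (by rw [hc v]; simp)
  have : Nonempty ({w : V // w ≠ v} ⊕ {x : V // G.Adj v x}) := ⟨Sum.inr ⟨x, hx⟩⟩
  exact ⟨hc.replaceByTriangle v, (hG.replaceByTriangle hc v).isThreeConnected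
    (hc.replaceByTriangle v), he.exists_replaceByTriangle hc hv⟩

theorem Generated.inU {V : Type u} {G : SimpleGraph V} (h : Generated G) : InU G := by
  induction h with
  | base G iso =>
    obtain ⟨φ⟩ := iso
    exact inU_completeGraph_four.of_iso
      ((SimpleGraph.Iso.completeGraph Equiv.ulift).trans φ.symm)
  | step G e v H hG he hv iso ih =>
    obtain ⟨φ⟩ := iso
    exact (ih.replaceByTriangle he hv).of_iso φ.symm

theorem IsCubic.nonempty_iso_completeGraph {V : Type u} {G : SimpleGraph V} (hc : IsCubic G)
    (hV : Nat.card V = 4) : Nonempty (G ≃g (⊤ : SimpleGraph (Fin 4))) := by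
  have hfin : Finite V := Nat.finite_of_card_ne_zero (by omega)
  have htop : G = ⊤ := by
    rw [SimpleGraph.eq_top_iff_forall_ne_adj]
    intro v w hne
    have h1 : insert v (G.neighborSet v) = Set.univ := by
      refine Set.eq_of_subset_of_ncard_le (Set.subset_univ _) ?_
      rw [Set.ncard_univ, hV, Set.ncard_insert_of_notMem (by simp), hc v]
    have h2 : w ∈ insert v (G.neighborSet v) := h1 ▸ Set.mem_univ w
    exact h2.resolve_left hne.symm
  subst htop
  exact ⟨SimpleGraph.Iso.completeGraph (Finite.equivFinOfCardEq hV)⟩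

/-- Passes from relations, which suit lifting and collapsing, to partner functions, which suit the
gluing of matchings in the barrier argument. -/
theorem IsLonely.exists_mate {V : Type u} {G : SimpleGraph V} {x y : V}
    (h : IsLonely G s(x, y)) : ∃ m, IsMate G m ∧ m x = y ∧ IsPM G (fun a b => m a = b) ∧
      ∀ m', IsMate G m' → m' x = m x → m' = m := by
  obtain ⟨R, ⟨hR, hxy⟩, hu⟩ := isLonely_iff.1 h
  have hpm : ∀ m, IsMate G m → IsPM G (fun a b => m a = b) := fun m hm =>
    ⟨fun a b hab => hab ▸ hm.2 a, fun a b hab => hab ▸ hm.1 a,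
      fun a => ⟨m a, rfl, fun b hb => hb.symm⟩⟩
  choose m hm hmu using hR.2.2
  have hmate : IsMate G m :=
    ⟨fun v => hR.2.1 _ _ (hm v), fun v => hR.eq (hm (m v)) (hR.1 _ _ (hm v))⟩
  have hmx : m x = y := hR.eq (hm x) hxy
  refine ⟨m, hmate, hmx, hpm m hmate, fun m' hm' hx => ?_⟩
  have h1 := hu _ ⟨hpm m' hm', hx.trans hmx⟩
  have h2 := hu _ ⟨hpm m hmate, hmx⟩
  funext a
  have h3 := congrFun (congrFun (h1.trans h2.symm) a) (m a)
  simpa using h3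

theorem InU.generated (n : ℕ) : ∀ {V : Type u} {G : SimpleGraph V}, Nat.card V = n → InU G →
    Generated G := by
  induction n using Nat.strong_induction_on with
  | _ n ih =>
  intro V G hn h
  obtain ⟨hc, h3, e, he⟩ := h
  rcases Nat.lt_or_ge 4 (Nat.card V) with hlt | hle
  swap
  · exact Generated.base G (hc.nonempty_iso_completeGraph (by have := h3.2.1; omega))
  classical
  have hfin : Finite V := h3.1
  have := Fintype.ofFinite V
  have hG := h3.cutsGeThree hc
  induction e with | _ x y
  obtain ⟨m, hm, hmx, hpm, hu⟩ := he.exists_mate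
  obtain ⟨a, c, hac, hbc⟩ := exists_triangle_of_unique hc hG hm hu
  rw [Nat.card_eq_fintype_card] at hlt
  set T : Set V := {a, m a, c} with hT
  obtain ⟨φ, hφ⟩ : ∃ φ : G ≃g CubicGraph.replaceByTriangle (contract G T) none,
      ∀ t ∈ T, ∃ y, φ t = Sum.inr y :=
    exists_iso_of_triangle hc hG hlt (hm.1 a) hac hbc
  obtain ⟨ya, hya⟩ := hφ a (by simp [hT])
  obtain ⟨yb, hyb⟩ := hφ (m a) (by simp [hT])
  have hc' := isCubic_of_iso φ hc
  have hH : IsCubic (contract G T) := by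
    refine isCubic_of_replaceByTriangle hc' ?_
    -- A new vertex has the same degree as the vertex that the triangle replaces.
    rw [← ncard_neighborSet_inr (Set.toFinite _) ya, hc']
  -- The triangle contains the matching edge `a`, `m a`, so the matching transported by `φ` has an
  -- edge in the new triangle.
  obtain ⟨e, he', hv⟩ := IsLonely.exists_of_replaceByTriangle hH (he.map φ) (hpm.comap φ.symm)
    (by simpa using hmx) (y := ya) (z := yb) (by rw [← hya, ← hyb]; simp)
  have hH3 : IsThreeConnected (contract G T) := by
    have := (isThreeConnected_of_iso φ h3).cutsGeThree hc'
    exact (cutsGeThree_of_replaceByTriangle this ⟨ya.1, ya.2⟩).isThreeConnected hH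
  refine Generated.step (contract G T) e none G (ih _ ?_ rfl ⟨hH, hH3, e, he'⟩) he' hv ⟨φ⟩
  have h1 : Nat.card {w : V // w ∉ T} = Tᶜ.ncard := rfl
  have h2 := Set.ncard_add_ncard_compl T
  -- Two elements of `T` suffice for the contraction to have fewer vertices.
  have h4 : ({a, m a} : Set V).ncard ≤ T.ncard := Set.ncard_le_ncard (by intro; simp [hT]; tauto)
  rw [Set.ncard_pair (hm.1 a).ne] at h4
  rw [Finite.card_option, h1]
  omega

end CubicGraph

theorem mainTheorem4 {V : Type u} (G : SimpleGraph V) :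
    CubicGraph.InU G ↔ CubicGraph.Generated G :=
  ⟨fun h => h.generated _ rfl, fun h => h.inU⟩
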